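/- A knot is a smoothly embedded oriented circle in the oriented sphere $S^3$. For a knot $K$ let $\nu(K)$ be an open tubular neighbourhood of $K$, let $E_K=S^3\setminus\nu(K)$ be its exterior, and let $G(K)=\pi_1(E_K)$ be its knot group. For a positive integer $p$ and an integer $q$ coprime to $p$, the $(p,q)$-cable $K^{(p,q)}$ of $K$ is the knot, well defined up to ambient isotopy, represented by the simple closed curve on the boundary of a closed tubular neighbourhood of $K$ that runs $p$ times along the preferred longitude of $K$ (the one that is null-homologous in $E_K$) and $q$ times along the meridian of $K$; that is, it is the satellite knot with companion $K$ and pattern the $(p,q)$-torus knot, with winding number $p$. Proposition. Let $p$ be a positive integer, $q$ an integer coprime to $p$, $K$ a knot in $S^3$, and $G$ a finite group whose order divides $p$. Then the image of every group homomorphism $f\colon G(K^{(p,q)})\to G$ is cyclic. -/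

import Mathlib

open scoped Manifold ContDiff

noncomputable section

/-- The standard smooth `3`-sphere, the unit sphere of `ℝ⁴`, oriented as the boundary of the
unit ball. -/
abbrev ThreeSphere : Type := Metric.sphere (0 : EuclideanSpace ℝ (Fin 4)) 1

/-- An (oriented) knot in `S³`: a smooth embedding of the circle. -/
structure Knot where
  toFun : Circle → ThreeSphere
  isSmoothEmbedding : Manifold.IsSmoothEmbedding (𝓡 1) (𝓡 3) ∞ toFun

/-- Two maps `S¹ → S³` are ambient isotopic: there is a smooth family `H t` (`t ∈ ℝ`) of
diffeomorphisms of `S³` with `H 0 = id` and `H 1 ∘ γ₀ = γ₁`. -/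
def AmbientIsotopic (γ₀ γ₁ : Circle → ThreeSphere) : Prop :=
  ∃ H : ℝ → (ThreeSphere ≃ₘ⟮𝓡 3, 𝓡 3⟯ ThreeSphere),
    ContMDiff (𝓘(ℝ, ℝ).prod (𝓡 3)) (𝓡 3) ∞ (fun x : ℝ × ThreeSphere => H x.1 x.2) ∧
    (∀ x, H 0 x = x) ∧ ∀ z, H 1 (γ₀ z) = γ₁ z

/-- A parametrised tubular neighbourhood of the knot `K`: an orientation preserving
diffeomorphism `Φ` of `S¹ × ℂ` onto an open subset of `S³` with `Φ(z, 0) = K(z)`.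
The product framing is arbitrary. -/
structure TubularNeighborhood (K : Knot) where
  toFun : Circle × ℂ → ThreeSphere
  smooth : ContMDiff ((𝓡 1).prod 𝓘(ℝ, ℂ)) (𝓡 3) ∞ toFun
  isOpenEmbedding : Topology.IsOpenEmbedding toFun
  core : ∀ z : Circle, toFun (z, 0) = K.toFun z
  /-- With `F(θ, x + iy) = Φ(e^{iθ}, x + iy)`, regarded as a vector of `ℝ⁴`, the vectors
  `F, ∂F/∂θ, ∂F/∂x, ∂F/∂y` form a positively oriented basis of `ℝ⁴`: the differential of `Φ`
  is invertible and preserves the orientation (outward normal of the sphere first). -/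
  orientation : ∀ (θ : ℝ) (w : ℂ),
    0 < Matrix.det (Matrix.of (fun i j : Fin 4 =>
      ((![(toFun (Circle.exp θ, w) : EuclideanSpace ℝ (Fin 4)),
        deriv (fun s : ℝ => (toFun (Circle.exp s, w) : EuclideanSpace ℝ (Fin 4))) θ,
        deriv (fun s : ℝ =>
          (toFun (Circle.exp θ, w + (s : ℂ)) : EuclideanSpace ℝ (Fin 4))) 0,
        deriv (fun s : ℝ =>
          (toFun (Circle.exp θ, w + (s : ℂ) * Complex.I) : EuclideanSpace ℝ (Fin 4))) 0] :
        Fin 4 → EuclideanSpace ℝ (Fin 4)) i) j))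

namespace TubularNeighborhood

variable {K : Knot} (T : TubularNeighborhood K)

/-- The open tubular neighbourhood `ν(K)`, the image of `S¹ × {|w| < 1}`. -/
def openNbhd : Set ThreeSphere := T.toFun '' {x | ‖x.2‖ < 1}

/-- The knot exterior `E_K = S³ \ ν(K)`. -/
def exterior : Set ThreeSphere := T.openNbhdᶜ

/-- The knot group `G(K) = π₁(E_K)`, with its base point displayed. -/
abbrev knotGroup (x : T.exterior) : Type := FundamentalGroup T.exterior x

theorem mem_exterior_of_norm_eq_one (z : Circle) (w : ℂ) (hw : ‖w‖ = 1) :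
    T.toFun (z, w) ∈ T.exterior := by
  rintro ⟨y, hy, hyz⟩
  have h := T.isOpenEmbedding.injective hyz
  subst h
  simp [hw] at hy

/-- The base point `Φ(1, 1)` of the longitude. -/
def basePoint : T.exterior := ⟨T.toFun (1, 1), T.mem_exterior_of_norm_eq_one 1 1 (by simp)⟩

/-- The longitude `t ↦ Φ(e^{2πit}, 1)` of the framing, a loop in the boundary of `E_K`. -/
def longitude : Path T.basePoint T.basePoint where
  toFun t := ⟨T.toFun (Circle.exp (2 * Real.pi * (t : ℝ)), 1),
    T.mem_exterior_of_norm_eq_one _ 1 (by simp)⟩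
  continuous_toFun := by
    refine Continuous.subtype_mk (T.isOpenEmbedding.continuous.comp ?_) _
    exact Continuous.prodMk (Circle.exp.continuous.comp (by fun_prop)) continuous_const
  source' := by simp [basePoint]
  target' := by simp [basePoint]

/-- The framing is the preferred one: the longitude vanishes in `H₁(E_K; ℤ)`, the abelianisation
of `π₁(E_K)`; that is, its linking number with `K` is zero. -/
def IsPreferred : Prop :=
  (FundamentalGroup.fromPath (Path.Homotopic.Quotient.mk T.longitude) :
      FundamentalGroup T.exterior T.basePoint) ∈
    commutator (FundamentalGroup T.exterior T.basePoint)

/-- The curve `z ↦ Φ(z^p, z^q)` on the torus `Φ(S¹ × S¹)`: it runs `p` times along the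
longitude and `q` times along the meridian of `K`. -/
def torusCurve (p : ℕ) (q : ℤ) : Circle → ThreeSphere :=
  fun z => T.toFun (z ^ p, ((z ^ q : Circle) : ℂ))

end TubularNeighborhood

/-- `J` is the `(p, q)`-cable of `K` (which is defined up to ambient isotopy): the satellite with
companion `K` whose pattern is the `(p, q)`-torus knot on the boundary of a solid torus, with
winding number `p`. -/
def Knot.IsCable (K : Knot) (p : ℕ) (q : ℤ) (J : Knot) : Prop :=
  ∃ T : TubularNeighborhood K, T.IsPreferred ∧ AmbientIsotopic (T.torusCurve p q) J.toFun

end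

/-! Cut the complement of the cable along the torus carrying it. The inner piece retracts onto the
core circle of the solid torus, the outer piece pushes off to the complement of `K`, and the two
overlap in a thickened annulus. A parallel of the cable in this annulus is homotopic inside to `p`
times the core, so it has trivial image because `g ^ p = 1` in `G`. Outside, it is `λ ^ p μ ^ q`
with `λ`, `μ` the longitude and meridian of the framing. Hence `μ ^ q = 1`; also `μ ^ p = 1`, so `μ
= 1` by coprimality (`dev_meridian_eq_one`).

The meridian normally generates the group of `K`, because filling in the core gives the simply
connected `S³`; so the outer piece has trivial image (`val_loop_eq_one_of_meridian`). As the overlap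
is connected, the whole image is generated by the value of the core
(`exists_gauge_cableComplement`).

Van Kampen arguments are phrased with functionals on paths. Subgroups generated by pieces become
statements about values after a change of gauge, and no base points have to be moved. -/

noncomputable section

open scoped unitInterval

/-! ### Local systems as functionals on paths -/

/-- A `G`-valued local system on `X`: a homotopy invariant functional on paths which is
multiplicative under concatenation. -/
structure LocalSystem (X : Type*) [TopologicalSpace X] (G : Type*) [Group G] where
  val : C(I, X) → G
  val_trans : ∀ {a b c : X} (γ : Path a b) (δ : Path b c),
    val (γ.trans δ).toContinuousMap = val γ.toContinuousMap * val δ.toContinuousMap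
  val_homotopic : ∀ {a b : X} {γ δ : Path a b}, γ.Homotopic δ →
    val γ.toContinuousMap = val δ.toContinuousMap

/-- A continuous map from the unit interval, as a path between its end points. -/
def ContinuousMap.toPath {X : Type*} [TopologicalSpace X] (γ : C(I, X)) : Path (γ 0) (γ 1) where
  toContinuousMap := γ
  source' := rfl
  target' := rfl

/-- The affine path between two points of the unit interval. -/
def unitInterval.segment (a b : I) : Path a b where
  toFun s := ⟨(1 - (s : ℝ)) * a + s * b, by
    have h := convex_Icc (0 : ℝ) 1 a.2 b.2 (a := 1 - (s : ℝ)) (b := s)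
      (by linarith [s.2.2]) s.2.1 (by ring)
    simpa using h⟩
  continuous_toFun := by fun_prop
  source' := by simp
  target' := by simp

theorem unitInterval.segment_mem_Icc {a b : I} (h : a ≤ b) (s : I) :
    unitInterval.segment a b s ∈ Set.Icc a b := by
  have h' : (a : ℝ) ≤ b := h
  have h0 := s.2.1
  have h1 := s.2.2
  constructor
  · change (a : ℝ) ≤ (1 - (s : ℝ)) * a + s * b
    nlinarith
  · change (1 - (s : ℝ)) * a + s * b ≤ (b : ℝ)
    nlinarith

instance : ContractibleSpace I :=
  (convex_Icc (0 : ℝ) 1).contractibleSpace ⟨0, by simp⟩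

namespace LocalSystem

variable {X Y : Type*} [TopologicalSpace X] [TopologicalSpace Y] {G : Type*} [Group G]
variable (L : LocalSystem X G)

theorem val_refl (a : X) : L.val (Path.refl a).toContinuousMap = 1 := by
  have h := L.val_trans (Path.refl a) (Path.refl a)
  rw [Path.refl_trans_refl] at h
  exact left_eq_mul.mp h

theorem val_const (a : X) : L.val (ContinuousMap.const I a) = 1 := L.val_refl a

theorem val_symm {a b : X} (γ : Path a b) :
    L.val γ.symm.toContinuousMap = (L.val γ.toContinuousMap)⁻¹ := by
  have h := L.val_trans γ γ.symm
  rw [← L.val_homotopic ⟨Path.Homotopy.reflTransSymm γ⟩, L.val_refl] at h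
  exact eq_inv_of_mul_eq_one_right h.symm

/-- The pullback of a local system along a continuous map. -/
def comap (h : C(Y, X)) : LocalSystem Y G where
  val γ := L.val (h.comp γ)
  val_trans γ δ := by
    have h' := L.val_trans (γ.map h.continuous) (δ.map h.continuous)
    rw [← Path.map_trans] at h'
    exact h'
  val_homotopic H := L.val_homotopic (H.map h)

theorem comap_val (h : C(Y, X)) (γ : C(I, Y)) : (L.comap h).val γ = L.val (h.comp γ) := rfl

/-- The local system obtained by a change of gauge. -/
def gauge (c : X → G) : LocalSystem X G where
  val γ := c (γ 0) * L.val γ * (c (γ 1))⁻¹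
  val_trans γ δ := by
    rw [L.val_trans]
    simp [mul_assoc]
  val_homotopic {a b γ δ} H := by
    rw [L.val_homotopic H]
    simp

theorem gauge_val (c : X → G) (γ : C(I, X)) :
    (L.gauge c).val γ = c (γ 0) * L.val γ * (c (γ 1))⁻¹ := rfl

/-- The parallel transport of a local system on a simply connected space. -/
def dev [SimplyConnectedSpace X] (a b : X) : G :=
  L.val (PathConnectedSpace.somePath a b).toContinuousMap

section SimplyConnected

variable [SimplyConnectedSpace X]

theorem val_path {a b : X} (γ : Path a b) : L.val γ.toContinuousMap = L.dev a b :=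
  L.val_homotopic (SimplyConnectedSpace.paths_homotopic _ _)

theorem val_eq_dev (γ : C(I, X)) : L.val γ = L.dev (γ 0) (γ 1) := L.val_path γ.toPath

theorem dev_mul_dev (a b c : X) : L.dev a b * L.dev b c = L.dev a c := by
  rw [dev, dev, ← L.val_trans, L.val_path]

theorem dev_self (a : X) : L.dev a a = 1 := by
  rw [← L.val_path (Path.refl a), L.val_refl]

theorem inv_dev (a b : X) : (L.dev a b)⁻¹ = L.dev b a :=
  inv_eq_of_mul_eq_one_right (by rw [dev_mul_dev, dev_self])

/-- Parallel transport is invariant under every self-map preserving the local system. -/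
theorem dev_map (h : C(X, X)) (hL : ∀ γ, L.val (h.comp γ) = L.val γ) (a b : X) :
    L.dev (h a) (h b) = L.dev a b := by
  conv_rhs => rw [dev, ← hL]
  rw [val_eq_dev]
  simp

end SimplyConnected

/-- In a square, the two ways around the boundary have the same value. -/
theorem val_square (h : C(I × I, X)) :
    L.val (h.comp ⟨fun t => (0, t), by fun_prop⟩) * L.val (h.comp ⟨fun s => (s, 1), by fun_prop⟩) =
      L.val (h.comp ⟨fun s => (s, 0), by fun_prop⟩) *
        L.val (h.comp ⟨fun t => (1, t), by fun_prop⟩) := by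
  simp only [← comap_val]
  simp only [val_eq_dev, ContinuousMap.coe_mk, dev_mul_dev]

/-- The value of a path moved by a homotopy. -/
theorem val_comp_of_homotopy {h₀ h₁ : C(Y, X)} (H : h₀.Homotopy h₁) (γ : C(I, Y)) :
    L.val (h₀.comp γ) = L.val (H.evalAt (γ 0)).toContinuousMap * L.val (h₁.comp γ) *
      (L.val (H.evalAt (γ 1)).toContinuousMap)⁻¹ := by
  have h := L.val_square (H.toContinuousMap.comp ⟨fun x : I × I => (x.1, γ x.2), by fun_prop⟩)
  rw [eq_mul_inv_iff_mul_eq]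
  convert h using 3 <;> ext t <;> simp [ContinuousMap.Homotopy.evalAt]

/-- A local system which vanishes on loops is trivial after a change of gauge. -/
theorem exists_gauge (hL : ∀ (a : X) (γ : Path a a), L.val γ.toContinuousMap = 1) :
    ∃ c : X → G, ∀ γ : C(I, X), c (γ 0) * L.val γ * (c (γ 1))⁻¹ = 1 := by
  -- Each path component gets one base point; the gauge at `y` is the value of a chosen path from it
  -- to `y`. The expression to be trivialised is then the value of a loop at that base point.
  have hrep : ∀ y : X, Joined (Quotient.mk (pathSetoid X) y).out y := fun y =>
    Quotient.exact (Quotient.out_eq (Quotient.mk (pathSetoid X) y))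
  refine ⟨fun y => L.val (hrep y).somePath.toContinuousMap, fun γ => ?_⟩
  have h : (Quotient.mk (pathSetoid X) (γ 0)).out = (Quotient.mk (pathSetoid X) (γ 1)).out :=
    congrArg _ (Quotient.sound ⟨γ.toPath⟩)
  have h' := hL _ ((((hrep (γ 0)).somePath.trans γ.toPath).trans (hrep (γ 1)).somePath.symm).cast
    rfl h)
  have h2 : ∀ {a b : X} (δ : Path a b) (e : a = b), L.val ((δ.cast rfl e)).toContinuousMap =
    L.val δ.toContinuousMap := fun _ _ => rfl
  rw [h2, L.val_trans, L.val_trans, L.val_symm] at h'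
  exact h'

/-! ### Subdivision along open covers -/

theorem prod_val_segment (L : LocalSystem I G) (u : ℕ → I) (n : ℕ) :
    ((List.range n).map fun m => L.val (unitInterval.segment (u m) (u (m + 1))).toContinuousMap).prod
      = L.dev (u 0) (u n) := by
  induction n with
  | zero => simp [dev_self]
  | succ n ih =>
    rw [List.range_succ, List.map_append, List.prod_append, ih]
    simp [val_path, dev_mul_dev]

/-- If the values on the paths inside the members of an open cover lie in a subgroup, then so do
all values. -/
theorem val_mem_of_cover {ι : Type*} {U : ι → Set X} (hU : ∀ i, IsOpen (U i))
    (hcov : ∀ x, ∃ i, x ∈ U i) (H : Subgroup G)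
    (hH : ∀ i (γ : C(I, X)), (∀ t, γ t ∈ U i) → L.val γ ∈ H) (γ : C(I, X)) : L.val γ ∈ H := by
  obtain ⟨u, hu0, hum, ⟨N, hN⟩, hu⟩ := exists_monotone_Icc_subset_open_cover_unitInterval
    (c := fun i => γ ⁻¹' U i) (fun i => (hU i).preimage γ.continuous)
    (fun t _ => by simpa using hcov (γ t))
  have h : L.val γ = (L.comap γ).val (ContinuousMap.id I) := by rw [comap_val]; rfl
  rw [h, val_eq_dev]
  have h := (L.comap γ).prod_val_segment u N
  rw [hu0, hN N le_rfl] at h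
  simp only [ContinuousMap.id_apply]
  rw [← h]
  refine H.list_prod_mem fun x hx => ?_
  obtain ⟨m, -, rfl⟩ := List.mem_map.mp hx
  obtain ⟨i, hi⟩ := hu m
  exact hH i _ fun t => hi (unitInterval.segment_mem_Icc (hum (Nat.le_succ m)) t)

/-- Local systems on the members of an open cover which are restrictions of one functional on
paths: the value on a loop in a member is trivial when the loop is contractible in the
whole space. -/
theorem val_eq_one_of_cover {ι : Type*} {U : ι → Set X} (hU : ∀ i, IsOpen (U i))
    (hcov : ∀ x, ∃ i, x ∈ U i) (F : C(I, X) → G) (M : ∀ i, LocalSystem (U i) G)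
    (hF : ∀ i (γ : C(I, U i)), F ((ContinuousMap.restrict (U i) (.id X)).comp γ) = (M i).val γ)
    (i₀ : ι) {a : U i₀} (γ : Path a a)
    (hγ : (γ.map continuous_subtype_val).Homotopic (Path.refl (a : X))) :
    (M i₀).val γ.toContinuousMap = 1 := by
  obtain ⟨H⟩ := hγ
  obtain ⟨u, hu0, hum, ⟨N, hN⟩, hu⟩ := exists_monotone_Icc_subset_open_cover_unitInterval_prod_self
    (c := fun i => H ⁻¹' U i) (fun i => (hU i).preimage H.continuous)
    (fun t _ => by simpa using hcov (H t))
  have hFc : F (ContinuousMap.const I (a : X)) = 1 := by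
    rw [← (M i₀).val_const a, ← hF]; rfl
  -- On the grid, `v n m` is an edge in the path direction at homotopy time `u n`, and `w n m` an
  -- edge in the homotopy direction. Each small square lies in one member of the cover and therefore
  -- commutes. The outer `w` edges are constant, so the product along a row does not depend on the
  -- row, and the last row is constant.
  let S (m : ℕ) := unitInterval.segment (u m) (u (m + 1))
  let v (n m : ℕ) : G := F (H.toContinuousMap.comp ⟨fun t => (u n, S m t), by fun_prop⟩)
  let w (n m : ℕ) : G := F (H.toContinuousMap.comp ⟨fun s => (S n s, u m), by fun_prop⟩)
  have hS0 : ∀ m, S m 0 = u m := fun m => Path.source _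
  have hS1 : ∀ m, S m 1 = u (m + 1) := fun m => Path.target _
  have hvw : ∀ n m, v n m * w n (m + 1) = w n m * v (n + 1) m := by
    intro n m
    obtain ⟨i, hi⟩ := hu n m
    have hmem : ∀ x : I × I, H (S n x.1, S m x.2) ∈ U i := fun x =>
      hi ⟨unitInterval.segment_mem_Icc (hum (Nat.le_succ n)) x.1,
        unitInterval.segment_mem_Icc (hum (Nat.le_succ m)) x.2⟩
    have h := (M i).val_square ⟨fun x : I × I => (⟨H (S n x.1, S m x.2), hmem x⟩ : U i), by fun_prop⟩
    simp only [← hF] at h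
    convert h using 3 <;> ext t <;> simp [hS0, hS1]
  have hV : ∀ n k, ((List.range k).map (v n)).prod * w n k =
      w n 0 * ((List.range k).map (v (n + 1))).prod := by
    intro n k
    induction k with
    | zero => simp
    | succ k ih =>
      simp only [List.range_succ, List.map_append, List.prod_append, List.map_cons, List.map_nil,
        List.prod_cons, List.prod_nil, mul_one]
      rw [mul_assoc, hvw, ← mul_assoc, ih, mul_assoc]
  have hw0 : ∀ n, w n 0 = 1 := fun n => by
    rw [← hFc]
    refine congrArg F (ContinuousMap.ext fun t => ?_)
    simp [hu0]
  have hwN : ∀ n, w n N = 1 := fun n => by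
    rw [← hFc]
    refine congrArg F (ContinuousMap.ext fun t => ?_)
    simp [hN N le_rfl]
  have hconst : ∀ n, ((List.range N).map (v 0)).prod = ((List.range N).map (v n)).prod := by
    intro n
    induction n with
    | zero => rfl
    | succ n ih =>
      have h := hV n N
      rw [hw0, hwN, mul_one, one_mul] at h
      rw [ih, h]
  have hvN : ((List.range N).map (v N)).prod = 1 := by
    refine List.prod_eq_one fun x hx => ?_
    obtain ⟨m, -, rfl⟩ := List.mem_map.mp hx
    rw [← hFc]
    refine congrArg F (ContinuousMap.ext fun t => ?_)
    simp [hN N le_rfl]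
  have h0 := ((M i₀).comap γ.toContinuousMap).prod_val_segment u N
  rw [hu0, hN N le_rfl] at h0
  have h1 : (M i₀).val γ.toContinuousMap =
      ((M i₀).comap γ.toContinuousMap).val (ContinuousMap.id I) := by rw [comap_val]; rfl
  rw [h1, val_eq_dev]
  simp only [ContinuousMap.id_apply]
  rw [← h0, ← hvN, ← hconst]
  congr 1
  refine List.map_congr_left fun m _ => ?_
  rw [comap_val, ← hF]
  refine congrArg F (ContinuousMap.ext fun t => ?_)
  simp [hu0, S]

end LocalSystem

/-! ### Gluing gauges; local systems from homomorphisms -/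

namespace LocalSystem

variable {X Y : Type*} [TopologicalSpace X] [TopologicalSpace Y] {G : Type*} [Group G]
variable (L : LocalSystem X G)

/-- A gauge for the restriction to a subset, as a function on the whole space. -/
theorem exists_gauge_of_restrict {A : Set X} (H : Subgroup G) (c : A → G)
    (hc : ∀ γ : C(I, A), ((L.comap ⟨Subtype.val, continuous_subtype_val⟩).gauge c).val γ ∈ H) :
    ∃ c' : X → G, ∀ γ : C(I, X), (∀ t, γ t ∈ A) → c' (γ 0) * L.val γ * (c' (γ 1))⁻¹ ∈ H := by
  classical
  refine ⟨fun x => if h : x ∈ A then c ⟨x, h⟩ else 1, fun γ hγ => ?_⟩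
  simp only [hγ, dif_pos]
  exact hc ⟨fun t => ⟨γ t, hγ t⟩, by fun_prop⟩

/-- Parallel transport from a base point of `A` is the gauge. The membership in `⊥` matches the form
needed for gluing. -/
theorem exists_gauge_of_isSimplyConnected {A : Set X} (hA : IsSimplyConnected A) :
    ∃ c : X → G, ∀ γ : C(I, X), (∀ t, γ t ∈ A) → c (γ 0) * L.val γ * (c (γ 1))⁻¹ ∈
      (⊥ : Subgroup G) := by
  have := hA.simplyConnectedSpace
  obtain ⟨a⟩ : Nonempty A := inferInstance
  refine L.exists_gauge_of_restrict ⊥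
    (fun y => (L.comap ⟨Subtype.val, continuous_subtype_val⟩).dev a y) fun γ => ?_
  rw [Subgroup.mem_bot, gauge_val, val_eq_dev, dev_mul_dev, mul_inv_cancel]

/-- Gauges on two open sets with path connected intersection can be glued. -/
theorem exists_gauge_of_union {A B : Set X} (hA : IsOpen A) (hB : IsOpen B)
    (hcov : ∀ x, x ∈ A ∨ x ∈ B) (hAB : IsPathConnected (A ∩ B)) (H : Subgroup G) {cA cB : X → G}
    (hcA : ∀ γ : C(I, X), (∀ t, γ t ∈ A) → cA (γ 0) * L.val γ * (cA (γ 1))⁻¹ ∈ (⊥ : Subgroup G))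
    (hcB : ∀ γ : C(I, X), (∀ t, γ t ∈ B) → cB (γ 0) * L.val γ * (cB (γ 1))⁻¹ ∈ H) :
    ∃ c : X → G, ∀ γ : C(I, X), c (γ 0) * L.val γ * (c (γ 1))⁻¹ ∈ H := by
  classical
  obtain ⟨b, hb, hj⟩ := hAB
  -- Multiplying by a constant on the left keeps trivial values trivial and makes the two gauges
  -- agree at `b`.
  let cA' : X → G := fun x => cB b * (cA b)⁻¹ * cA x
  -- Along a path from `b` to `x` inside the overlap both gauges apply, so their discrepancy at `x`
  -- is a value in `H`.
  have hmem : ∀ x ∈ A ∩ B, cB x * (cA' x)⁻¹ ∈ H := by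
    intro x hx
    have hγ := (hj hx).somePath_mem
    set γ := (hj hx).somePath
    have h1 := hcA γ.toContinuousMap fun t => (hγ t).1
    have h2 := hcB γ.toContinuousMap fun t => (hγ t).2
    have e0 : γ.toContinuousMap 0 = b := γ.source
    have e1 : γ.toContinuousMap 1 = x := γ.target
    rw [e0, e1] at h1 h2
    rw [Subgroup.mem_bot, mul_inv_eq_one] at h1
    have : cB x * (cA' x)⁻¹ = (cB b * L.val γ.toContinuousMap * (cB x)⁻¹)⁻¹ := by
      simp only [cA', ← h1]
      group
    rw [this]
    exact H.inv_mem h2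
  let c : X → G := fun x => if x ∈ B then cB x else cA' x
  have hc : ∀ x ∈ A, c x * (cA' x)⁻¹ ∈ H := by
    intro x hx
    by_cases hxB : x ∈ B
    · simpa [c, hxB] using hmem x ⟨hx, hxB⟩
    · simp [c, hxB]
  refine ⟨c, fun γ => ?_⟩
  refine (L.gauge c).val_mem_of_cover (U := fun b : Bool => if b then A else B) ?_ ?_ H ?_ γ
  · rintro (_ | _) <;> simpa
  · intro x
    rcases hcov x with h | h
    · exact ⟨true, by simpa⟩
    · exact ⟨false, by simpa⟩
  · rintro (_ | _) γ hγ
    · simp only [Bool.false_eq_true, if_false] at hγ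
      rw [gauge_val]
      simp only [c, hγ, if_true]
      exact hcB γ hγ
    · simp only [if_true] at hγ
      rw [gauge_val]
      have h1 := hcA γ hγ
      rw [Subgroup.mem_bot, mul_inv_eq_one] at h1
      have : c (γ 0) * L.val γ * (c (γ 1))⁻¹ =
          c (γ 0) * (cA' (γ 0))⁻¹ * (c (γ 1) * (cA' (γ 1))⁻¹)⁻¹ := by
        simp only [cA', ← h1]
        group
      rw [this]
      exact H.mul_mem (hc _ (hγ 0)) (H.inv_mem (hc _ (hγ 1)))

/-- The class of a loop in the fundamental group. -/
abbrev _root_.FundamentalGroup.ofLoop {x : X} (γ : Path x x) : FundamentalGroup X x :=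
  FundamentalGroup.fromPath (Path.Homotopic.Quotient.mk γ)

/-- The product of `FundamentalGroup` is opposite to concatenation of loops; this is why `ofHomVal`
takes an inverse. -/
theorem map_ofLoop_trans {x : X} (f : FundamentalGroup X x →* G) (γ δ : Path x x) :
    f (.ofLoop (γ.trans δ)) = f (.ofLoop δ) * f (.ofLoop γ) := by
  rw [← map_mul]; rfl

open Classical in
/-- The functional underlying `LocalSystem.ofHom`. -/
def ofHomVal {x : X} (f : FundamentalGroup X x →* G) (γ : C(I, X)) : G :=
  if h : Joined x (γ 0) then
    -- `somePath` depends only on its end points, so the connecting paths cancel under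
    -- concatenation. Paths outside the component of `x` get the value `1`.
    (f (.ofLoop ((h.somePath.trans γ.toPath).trans (h.trans ⟨γ.toPath⟩).somePath.symm)))⁻¹
  else 1

theorem ofHomVal_path {x : X} (f : FundamentalGroup X x →* G) {a b : X} (γ : Path a b)
    (ha : Joined x a) (hb : Joined x b) : ofHomVal f γ.toContinuousMap =
      (f (.ofLoop ((ha.somePath.trans γ).trans hb.somePath.symm)))⁻¹ := by
  obtain ⟨γ, rfl, rfl⟩ := γ
  exact dif_pos ha

theorem ofHomVal_of_not_joined {x : X} (f : FundamentalGroup X x →* G) {a b : X} (γ : Path a b)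
    (ha : ¬ Joined x a) : ofHomVal f γ.toContinuousMap = 1 := by
  obtain ⟨γ, rfl, rfl⟩ := γ
  exact dif_neg ha

/-- The local system with prescribed monodromy at a base point. -/
def ofHom {x : X} (f : FundamentalGroup X x →* G) : LocalSystem X G where
  val := ofHomVal f
  val_trans {a b c} γ δ := by
    by_cases ha : Joined x a
    · have hb := ha.trans ⟨γ⟩
      have hc := hb.trans ⟨δ⟩
      rw [ofHomVal_path f _ ha hc, ofHomVal_path f _ ha hb, ofHomVal_path f _ hb hc, ← mul_inv_rev,
        ← map_ofLoop_trans]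
      congr 2
      simp only [FundamentalGroup.ofLoop, Path.Homotopic.Quotient.mk_trans,
        Path.Homotopic.Quotient.mk_symm, Path.Homotopic.Quotient.trans_assoc]
      rw [← Path.Homotopic.Quotient.trans_assoc (.symm _) (.mk hb.somePath)]
      simp
    · have hb : ¬ Joined x b := fun h => ha (h.trans ⟨γ.symm⟩)
      rw [ofHomVal_of_not_joined f _ ha, ofHomVal_of_not_joined f _ ha,
        ofHomVal_of_not_joined f _ hb, mul_one]
  val_homotopic {a b γ δ} h := by
    by_cases ha : Joined x a
    · have hb := ha.trans ⟨γ⟩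
      rw [ofHomVal_path f _ ha hb, ofHomVal_path f _ ha hb]
      congr 2
      exact Path.Homotopic.Quotient.eq.mpr (((Path.Homotopic.refl _).hcomp h).hcomp (.refl _))
    · rw [ofHomVal_of_not_joined f _ ha, ofHomVal_of_not_joined f _ ha]

/-- The conjugation appears because the chosen path from `x` to itself need not be constant. -/
theorem exists_ofHom_val {x : X} (f : FundamentalGroup X x →* G) :
    ∃ g : G, ∀ γ : Path x x,
      (ofHom f).val γ.toContinuousMap = g * (f (.ofLoop γ))⁻¹ * g⁻¹ := by
  refine ⟨(f (.ofLoop (Joined.refl x).somePath))⁻¹, fun γ => ?_⟩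
  have h := ofHomVal_path f γ (Joined.refl x) (Joined.refl x)
  refine h.trans ?_
  rw [map_ofLoop_trans, map_ofLoop_trans]
  have h2 : f (.ofLoop (Joined.refl x).somePath.symm) =
      (f (.ofLoop (Joined.refl x).somePath))⁻¹ := by
    rw [← map_inv]; rfl
  rw [h2]
  group

end LocalSystem

/-! ### Simple connectivity of the sphere -/

/-- The union of two simply connected open sets with path connected intersection is simply
connected. -/
theorem SimplyConnectedSpace.of_union {X : Type*} [TopologicalSpace X] {A B : Set X}
    (hA : IsOpen A) (hB : IsOpen B) (hcov : ∀ x, x ∈ A ∨ x ∈ B) (hAB : IsPathConnected (A ∩ B))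
    (hA' : IsSimplyConnected A) (hB' : IsSimplyConnected B) : SimplyConnectedSpace X := by
  rw [simply_connected_iff_loops_nullhomotopic]
  constructor
  · rw [pathConnectedSpace_iff_univ, ← Set.eq_univ_of_forall (s := A ∪ B) hcov]
    exact hA'.isPathConnected.union hB'.isPathConnected hAB.nonempty
  · intro x γ
    -- The local system of the identity homomorphism detects every loop, so trivialising it shows
    -- that all loops are null-homotopic.
    let f : FundamentalGroup X x →* FundamentalGroup X x := MonoidHom.id _
    obtain ⟨cA, hcA⟩ := (LocalSystem.ofHom f).exists_gauge_of_isSimplyConnected hA'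
    obtain ⟨cB, hcB⟩ := (LocalSystem.ofHom f).exists_gauge_of_isSimplyConnected hB'
    obtain ⟨c, hc⟩ := (LocalSystem.ofHom f).exists_gauge_of_union hA hB hcov hAB ⊥ hcA hcB
    obtain ⟨g, hg⟩ := LocalSystem.exists_ofHom_val f
    have h := hc γ.toContinuousMap
    have e0 : γ.toContinuousMap 0 = x := γ.source
    have e1 : γ.toContinuousMap 1 = x := γ.target
    rw [e0, e1, hg, Subgroup.mem_bot, conj_eq_one_iff, conj_eq_one_iff, inv_eq_one] at h
    exact Path.Homotopic.Quotient.eq.mp h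

theorem isSimplyConnected_compl_singleton_sphere {n : ℕ}
    (v : Metric.sphere (0 : EuclideanSpace ℝ (Fin n)) 1) :
    IsSimplyConnected ({v}ᶜ : Set (Metric.sphere (0 : EuclideanSpace ℝ (Fin n)) 1)) := by
  have hv : ‖(v : EuclideanSpace ℝ (Fin n))‖ = 1 := by simp
  have e := (stereographic hv).toHomeomorphSourceTarget
  rw [stereographic_source, stereographic_target] at e
  have : SimplyConnectedSpace (Set.univ : Set (ℝ ∙ (v : EuclideanSpace ℝ (Fin n)))ᗮ) :=
    (Homeomorph.Set.univ _).toHomotopyEquiv.simplyConnectedSpace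
  exact e.toHomotopyEquiv.simplyConnectedSpace

/-- The complements of two antipodal points cover the sphere. Stereographic projection identifies
their intersection with a `3`-dimensional space minus a point. -/
instance : SimplyConnectedSpace ThreeSphere := by
  obtain ⟨v⟩ : Nonempty ThreeSphere := ⟨⟨EuclideanSpace.single 0 1, by simp⟩⟩
  have hvv : v ≠ -v := fun h => by
    have := ne_neg_of_mem_unit_sphere ℝ v
    exact this h
  refine SimplyConnectedSpace.of_union (A := {v}ᶜ) (B := {-v}ᶜ) isOpen_compl_singleton
    isOpen_compl_singleton ?_ ?_ (isSimplyConnected_compl_singleton_sphere v)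
    (isSimplyConnected_compl_singleton_sphere (-v))
  · intro x
    by_cases h : x = v
    · exact .inr fun h' => hvv (h ▸ h')
    · exact .inl h
  · have hv : ‖(v : EuclideanSpace ℝ (Fin 4))‖ = 1 := by simp
    let e := stereographic hv
    have hne : -v ∈ e.source := by
      rw [stereographic_source]; exact fun h => hvv h.symm
    have himg : ({v}ᶜ ∩ {-v}ᶜ : Set ThreeSphere) = e.symm '' {e (-v)}ᶜ := by
      ext x
      constructor
      · rintro ⟨h1, h2⟩
        have hx : x ∈ e.source := by rwa [stereographic_source]
        exact ⟨e x, fun h => h2 (e.injOn hx hne h), e.left_inv hx⟩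
      · rintro ⟨y, hy, rfl⟩
        have hy' : y ∈ e.target := by rw [stereographic_target]; trivial
        have h := e.map_target hy'
        rw [stereographic_source] at h
        exact ⟨h, fun h' => hy (by rw [← Set.mem_singleton_iff.mp h', e.right_inv hy']; rfl)⟩
    rw [himg]
    have hrank : 1 < Module.rank ℝ (ℝ ∙ (v : EuclideanSpace ℝ (Fin 4)))ᗮ := by
      have : Fact (Module.finrank ℝ (EuclideanSpace ℝ (Fin 4)) = 3 + 1) := ⟨by simp⟩
      have h := Submodule.finrank_orthogonal_span_singleton (𝕜 := ℝ) (n := 3)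
        (v := (v : EuclideanSpace ℝ (Fin 4))) (ne_zero_of_mem_unit_sphere v)
      rw [← Module.finrank_eq_rank, h]
      norm_num
    refine (isPathConnected_compl_singleton_of_one_lt_rank hrank _).image' ?_
    exact e.continuousOn_symm.mono fun y _ => by rw [stereographic_target]; trivial

/-! ### Radial pushing and polar coordinates in a tubular neighbourhood -/

namespace TubularNeighborhood

variable {K : Knot} (T : TubularNeighborhood K)

theorem toFun_inj {x y : Circle × ℂ} : T.toFun x = T.toFun y ↔ x = y :=
  T.isOpenEmbedding.injective.eq_iff

theorem range_core : Set.range K.toFun = T.toFun '' {x | x.2 = 0} := by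
  ext y
  constructor
  · rintro ⟨z, rfl⟩
    exact ⟨(z, 0), rfl, T.core z⟩
  · rintro ⟨⟨z, w⟩, rfl : w = 0, rfl⟩
    exact ⟨z, (T.core z).symm⟩

theorem toFun_mem_compl_core {z : Circle} {w : ℂ} (hw : w ≠ 0) :
    T.toFun (z, w) ∈ (Set.range K.toFun)ᶜ := by
  rw [T.range_core]
  rintro ⟨x, hx, h⟩
  rw [T.toFun_inj.mp h] at hx
  exact hw hx

theorem exists_toFun_eq {y : ThreeSphere} (hy : y ∈ (Set.range K.toFun)ᶜ)
    (hr : y ∈ Set.range T.toFun) : ∃ z w, w ≠ 0 ∧ T.toFun (z, w) = y := by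
  obtain ⟨⟨z, w⟩, rfl⟩ := hr
  exact ⟨z, w, fun h => hy ⟨z, by rw [h, T.core]⟩, rfl⟩

theorem isClosed_image {S : Set (Circle × ℂ)} (hS : IsClosed S) {r : ℝ}
    (hr : ∀ x ∈ S, ‖x.2‖ ≤ r) : IsClosed (T.toFun '' S) := by
  refine (IsCompact.image ?_ T.isOpenEmbedding.continuous).isClosed
  refine (isCompact_univ.prod (isCompact_closedBall (0 : ℂ) r)).of_isClosed_subset hS ?_
  exact fun x hx => ⟨trivial, by simpa using hr x hx⟩

open Classical in
/-- The radial push away from the core: at time `1` the punctured disc bundle of radius `s` is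
pushed onto its boundary. -/
def push (s : ℝ) (x : ℝ × ThreeSphere) : ThreeSphere :=
  if h : x.2 ∈ Set.range T.toFun then
    -- The factor is `1` when `‖w‖ ≥ s`, and at time `1` it carries smaller nonzero `w` to radius
    -- `s`. On the core `s / 0 = 0` makes it `1`; continuity is only claimed off the core.
    T.toFun (h.choose.1, ((1 - x.1 + x.1 * max 1 (s / ‖h.choose.2‖) : ℝ) : ℂ) * h.choose.2)
  else x.2

theorem push_toFun (s t : ℝ) (z : Circle) (w : ℂ) : T.push s (t, T.toFun (z, w)) =
    T.toFun (z, ((1 - t + t * max 1 (s / ‖w‖) : ℝ) : ℂ) * w) := by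
  have h : T.toFun (z, w) ∈ Set.range T.toFun := ⟨_, rfl⟩
  rw [push, dif_pos h]
  have hc := T.toFun_inj.mp h.choose_spec
  rw [hc]

theorem push_of_notMem (s t : ℝ) {y : ThreeSphere} (hy : y ∉ Set.range T.toFun) :
    T.push s (t, y) = y := dif_neg hy

theorem push_zero (s : ℝ) (y : ThreeSphere) : T.push s (0, y) = y := by
  by_cases hy : y ∈ Set.range T.toFun
  · obtain ⟨⟨z, w⟩, rfl⟩ := hy
    simp [push_toFun]
  · exact T.push_of_notMem s 0 hy

theorem push_of_notMem_image {s : ℝ} (hs : 0 < s) (t : ℝ) {y : ThreeSphere}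
    (hy : y ∉ T.toFun '' {x | ‖x.2‖ < s}) : T.push s (t, y) = y := by
  by_cases hr : y ∈ Set.range T.toFun
  · obtain ⟨⟨z, w⟩, rfl⟩ := hr
    have hw : s ≤ ‖w‖ := not_lt.mp fun h => hy ⟨(z, w), h, rfl⟩
    rw [push_toFun, max_eq_left ((div_le_one (hs.trans_le hw)).mpr hw)]
    simp
  · exact T.push_of_notMem s t hr

theorem push_one_notMem {s : ℝ} {y : ThreeSphere} (hy : y ∈ (Set.range K.toFun)ᶜ) :
    T.push s (1, y) ∉ T.toFun '' {x | ‖x.2‖ < s} := by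
  rintro ⟨⟨z', w'⟩, hw', h⟩
  by_cases hr : y ∈ Set.range T.toFun
  · obtain ⟨z, w, hw, rfl⟩ := T.exists_toFun_eq hy hr
    rw [push_toFun, T.toFun_inj, Prod.mk.injEq] at h
    have hw0 : 0 < ‖w‖ := norm_pos_iff.mpr hw
    have h2 : ‖w'‖ = max 1 (s / ‖w‖) * ‖w‖ := by
      rw [h.2, norm_mul, Complex.norm_real, Real.norm_of_nonneg (by simp)]
      simp
    have h3 : s / ‖w‖ * ‖w‖ ≤ ‖w'‖ := by
      rw [h2]; gcongr; exact le_max_right _ _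
    rw [div_mul_cancel₀ _ hw0.ne'] at h3
    exact absurd hw' (not_lt.mpr h3)
  · rw [T.push_of_notMem s 1 hr] at h
    exact hr ⟨_, h⟩

/-- Inside the tube the formula is continuous for `w ≠ 0`. A point outside has a neighbourhood
missing the compact tube of radius `s`, where the push is the identity. -/
theorem continuousAt_push {s : ℝ} (hs : 0 < s) (t : ℝ) {y : ThreeSphere}
    (hy : y ∈ (Set.range K.toFun)ᶜ) : ContinuousAt (T.push s) (t, y) := by
  by_cases hr : y ∈ Set.range T.toFun
  · obtain ⟨z, w, hw, rfl⟩ := T.exists_toFun_eq hy hr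
    have he : Topology.IsOpenEmbedding (Prod.map (id : ℝ → ℝ) T.toFun) :=
      Topology.IsOpenEmbedding.id.prodMap T.isOpenEmbedding
    change ContinuousAt _ (Prod.map id T.toFun (t, (z, w)))
    rw [← he.continuousAt_iff]
    have : T.push s ∘ Prod.map (id : ℝ → ℝ) T.toFun = fun x : ℝ × (Circle × ℂ) =>
        T.toFun (x.2.1, ((1 - x.1 + x.1 * max 1 (s / ‖x.2.2‖) : ℝ) : ℂ) * x.2.2) := by
      ext1 ⟨t, z, w⟩
      exact T.push_toFun s t z w
    rw [this]
    refine T.isOpenEmbedding.continuous.continuousAt.comp ?_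
    have hw' : ‖w‖ ≠ 0 := norm_ne_zero_iff.mpr hw
    have h1 : ContinuousAt (fun x : ℝ × (Circle × ℂ) => s / ‖x.2.2‖) (t, z, w) :=
      ContinuousAt.div continuousAt_const (by fun_prop) hw'
    have h2 : ContinuousAt (fun x : ℝ × (Circle × ℂ) => max 1 (s / ‖x.2.2‖)) (t, z, w) :=
      continuousAt_const.max h1
    refine ContinuousAt.prodMk (by fun_prop) ?_
    refine ContinuousAt.mul ?_ (by fun_prop)
    refine Complex.continuous_ofReal.continuousAt.comp ?_
    fun_prop
  · have hcl : IsClosed (T.toFun '' {x | ‖x.2‖ ≤ s}) :=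
      T.isClosed_image (isClosed_le (by fun_prop) continuous_const) fun x hx => hx
    have hev : ∀ᶠ x : ℝ × ThreeSphere in nhds (t, y), T.push s x = x.2 := by
      have : ∀ᶠ x : ℝ × ThreeSphere in nhds (t, y), x.2 ∈ (T.toFun '' {x | ‖x.2‖ ≤ s})ᶜ := by
        refine continuous_snd.continuousAt.eventually_mem (hcl.isOpen_compl.mem_nhds ?_)
        rintro ⟨x, -, h⟩
        exact hr ⟨x, h⟩
      filter_upwards [this] with x hx
      refine T.push_of_notMem_image hs x.1 fun h => hx ?_
      exact Set.image_mono (fun _ (h : _ < s) => le_of_lt h) h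
    exact continuous_snd.continuousAt.congr (hev.mono fun _ h => h.symm)

theorem continuous_push {s : ℝ} (hs : 0 < s) {Y : Type*} [TopologicalSpace Y] {f : Y → ℝ}
    {g : Y → ThreeSphere} (hf : Continuous f) (hg : Continuous g)
    (h : ∀ y, g y ∈ (Set.range K.toFun)ᶜ) : Continuous fun y => T.push s (f y, g y) :=
  continuous_iff_continuousAt.mpr fun y =>
    ContinuousAt.comp (f := fun y => (f y, g y)) (T.continuousAt_push hs (f y) (h y))
      (hf.prodMk hg).continuousAt

/-- The retraction of the complement of the knot onto its exterior. -/
def retraction : C(((Set.range K.toFun)ᶜ : Set ThreeSphere), T.exterior) where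
  toFun y := ⟨T.push 1 (1, y), T.push_one_notMem y.2⟩
  continuous_toFun := Continuous.subtype_mk
    (T.continuous_push one_pos continuous_const continuous_subtype_val fun y => y.2) _

theorem retraction_of_mem_exterior (y : ((Set.range K.toFun)ᶜ : Set ThreeSphere))
    (hy : (y : ThreeSphere) ∈ T.exterior) : T.retraction y = ⟨y, hy⟩ :=
  Subtype.ext (T.push_of_notMem_image one_pos 1 hy)

theorem exterior_subset : T.exterior ⊆ (Set.range K.toFun)ᶜ := by
  rw [T.range_core, exterior, Set.compl_subset_compl, openNbhd]
  refine Set.image_mono fun x hx => ?_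
  simp only [Set.mem_ofPred_eq] at hx ⊢
  simp [hx]

/-- Polar coordinates on the punctured tubular neighbourhood. -/
def polar : C(ℝ × ℂ, ((Set.range K.toFun)ᶜ : Set ThreeSphere)) where
  toFun x := ⟨T.toFun (Circle.exp x.1, Complex.exp x.2),
    T.toFun_mem_compl_core (Complex.exp_ne_zero _)⟩
  continuous_toFun := Continuous.subtype_mk (T.isOpenEmbedding.continuous.comp (by fun_prop)) _

theorem polar_add_fst (x : ℝ × ℂ) : T.polar (x + (2 * Real.pi, 0)) = T.polar x :=
  Subtype.ext (by simp [polar])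

theorem polar_add_snd (x : ℝ × ℂ) : T.polar (x + (0, 2 * Real.pi * Complex.I)) = T.polar x :=
  Subtype.ext (by simp [polar, Complex.exp_periodic _])

end TubularNeighborhood

/-! ### Transport of periodic local systems -/

namespace LocalSystem

variable {G : Type*} [Group G]

section Translation

variable {E : Type*} [TopologicalSpace E] [AddCommGroup E]
  [SimplyConnectedSpace E] (P : LocalSystem E G)

theorem dev_add_nsmul {v : E} (hv : ∀ a b, P.dev (a + v) (b + v) = P.dev a b) (a b : E) (n : ℕ) :
    P.dev (a + n • v) (b + n • v) = P.dev a b := by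
  induction n with
  | zero => simp
  | succ n ih => rw [succ_nsmul, ← add_assoc, ← add_assoc, hv, ih]

theorem dev_nsmul {v : E} (hv : ∀ a b, P.dev (a + v) (b + v) = P.dev a b) (a : E) (n : ℕ) :
    P.dev a (a + n • v) = P.dev a (a + v) ^ n := by
  induction n with
  | zero => simp [dev_self]
  | succ n ih =>
    rw [← P.dev_mul_dev a (a + n • v), ih, pow_succ, succ_nsmul', ← add_assoc,
      P.dev_add_nsmul hv]

theorem dev_zsmul {v : E} (hv : ∀ a b, P.dev (a + v) (b + v) = P.dev a b) (a : E) (n : ℤ) :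
    P.dev a (a + n • v) = P.dev a (a + v) ^ n := by
  obtain ⟨n, rfl | rfl⟩ := n.eq_nat_or_neg
  · simpa using P.dev_nsmul hv a n
  · have hv' : ∀ a b, P.dev (a + -v) (b + -v) = P.dev a b := fun a b => by
      rw [← hv (a + -v) (b + -v)]; simp
    have h := P.dev_nsmul hv' a n
    have h2 : P.dev a (a + -v) = (P.dev a (a + v))⁻¹ := by
      rw [inv_dev, ← hv a]; simp
    rw [h2] at h
    simpa using h

theorem dev_add_zsmul {v : E} (hv : ∀ a b, P.dev (a + v) (b + v) = P.dev a b) (a b : E) (n : ℤ) :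
    P.dev (a + n • v) (b + n • v) = P.dev a b := by
  obtain ⟨n, rfl | rfl⟩ := n.eq_nat_or_neg
  · simpa using P.dev_add_nsmul hv a b n
  · rw [← P.dev_add_nsmul hv (a + (-(n : ℤ)) • v) (b + (-(n : ℤ)) • v) n]
    simp

theorem dev_comap_add [ContinuousAdd E] {X : Type*} [TopologicalSpace X] (L : LocalSystem X G)
    (h : C(E, X)) {v : E}
    (hv : ∀ x, h (x + v) = h x) (a b : E) :
    (L.comap h).dev (a + v) (b + v) = (L.comap h).dev a b := by
  refine (L.comap h).dev_map ⟨fun x => x + v, by fun_prop⟩ (fun γ => ?_) a b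
  rw [comap_val, comap_val]
  congr 1
  ext t
  exact hv _

end Translation
end LocalSystem

theorem Circle.exists_eq_add_of_exp_eq {x y : ℝ} (h : Circle.exp x = Circle.exp y) :
    ∃ n : ℤ, y = x + n * (2 * Real.pi) := by
  obtain ⟨n, hn⟩ := Circle.exp_eq_exp.mp h.symm
  exact ⟨n, hn⟩

/-! ### Normal generation by the meridian -/

namespace TubularNeighborhood

variable {K : Knot} (T : TubularNeighborhood K) {G : Type*} [Group G]

/-- The inverse of the parametrisation of a tubular neighbourhood. -/
def coords : C(Set.range T.toFun, Circle × ℂ) :=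
  ⟨T.isOpenEmbedding.isEmbedding.toHomeomorph.symm, Homeomorph.continuous _⟩

theorem toFun_coords (y : Set.range T.toFun) : T.toFun (T.coords y) = y :=
  congrArg Subtype.val (T.isOpenEmbedding.isEmbedding.toHomeomorph.apply_symm_apply y)

theorem coords_eq {y : Set.range T.toFun} {x : Circle × ℂ} (h : T.toFun x = y) :
    T.coords y = x := T.toFun_inj.mp ((T.toFun_coords y).trans h.symm)

/-- Paths in the punctured tubular neighbourhood lift to polar coordinates. -/
theorem exists_polar_lift (γ : C(I, ((Set.range K.toFun)ᶜ : Set ThreeSphere)))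
    (hγ : ∀ t, (γ t : ThreeSphere) ∈ Set.range T.toFun) :
    ∃ Γ : C(I, ℝ × ℂ), T.polar.comp Γ = γ := by
  let δ : C(I, Circle × ℂ) := T.coords.comp ⟨fun t => ⟨γ t, hγ t⟩, by fun_prop⟩
  have hδ : ∀ t, T.toFun (δ t) = γ t := fun t => T.toFun_coords _
  have hδ0 : ∀ t, (δ t).2 ≠ 0 := by
    intro t h
    obtain ⟨z, w, hw, hzw⟩ := T.exists_toFun_eq (γ t).2 (hγ t)
    rw [← hδ, T.toFun_inj] at hzw
    rw [← hzw] at h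
    exact hw h
  obtain ⟨A, hA, -⟩ := Circle.isCoveringMap_exp.exists_path_lifts
    ⟨fun t => (δ t).1, by fun_prop⟩ (Complex.arg (δ 0).1) (by simp)
  obtain ⟨B, hB, -⟩ := Complex.isCoveringMap_exp.exists_path_lifts
    ⟨fun t => ⟨(δ t).2, hδ0 t⟩, by fun_prop⟩ (Complex.log (δ 0).2)
    (Subtype.ext (by simp [Complex.exp_log (hδ0 0)]))
  refine ⟨A.prodMk B, ContinuousMap.ext fun t => Subtype.ext ?_⟩
  have hA' := congrFun hA t
  have hB' := congrArg Subtype.val (congrFun hB t)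
  simp only [Function.comp_apply, ContinuousMap.coe_mk] at hA' hB'
  change T.toFun (Circle.exp (A t), Complex.exp (B t)) = _
  rw [hA', hB', ← hδ]

theorem exists_polar_eq {x y : ℝ × ℂ} (h : T.polar x = T.polar y) :
    ∃ m n : ℤ, y = x + m • (2 * Real.pi, (0 : ℂ)) + n • ((0 : ℝ), 2 * Real.pi * Complex.I) := by
  have h' := T.toFun_inj.mp (congrArg Subtype.val h)
  rw [Prod.mk.injEq] at h'
  obtain ⟨m, hm⟩ := Circle.exists_eq_add_of_exp_eq h'.1
  obtain ⟨n, hn⟩ := Complex.exp_eq_exp_iff_exists_int.mp h'.2.symm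
  exact ⟨m, n, Prod.ext (by simp [hm]) (by simp [hn])⟩

variable (M : LocalSystem ((Set.range K.toFun)ᶜ : Set ThreeSphere) G)

theorem dev_polar_add_fst (a b : ℝ × ℂ) :
    (M.comap T.polar).dev (a + (2 * Real.pi, 0)) (b + (2 * Real.pi, 0)) =
      (M.comap T.polar).dev a b := LocalSystem.dev_comap_add M T.polar T.polar_add_fst a b

theorem dev_polar_add_snd (a b : ℝ × ℂ) :
    (M.comap T.polar).dev (a + (0, 2 * Real.pi * Complex.I)) (b + (0, 2 * Real.pi * Complex.I)) =
      (M.comap T.polar).dev a b := LocalSystem.dev_comap_add M T.polar T.polar_add_snd a b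

/-- The knot group is normally generated by the meridian: a local system on the knot complement
with trivial meridian is trivial on all loops. -/
theorem val_loop_eq_one_of_meridian
    (hM : ∀ a, (M.comap T.polar).dev a (a + (0, 2 * Real.pi * Complex.I)) = 1)
    {a : ((Set.range K.toFun)ᶜ : Set ThreeSphere)} (γ : Path a a) :
    M.val γ.toContinuousMap = 1 := by
  classical
  set P := M.comap T.polar with hP
  -- Transport from radius `1`, angle `0` to `x` does not depend on the polar lift: longitudinal
  -- shifts preserve transport, and meridional shifts contribute powers of the trivial meridian.
  have hradial : ∀ x y : ℝ × ℂ, T.polar x = T.polar y →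
      P.dev (x.1, 0) x = P.dev (y.1, 0) y := by
    intro x y h
    obtain ⟨m, n, rfl⟩ := T.exists_polar_eq h
    rw [← P.dev_mul_dev _ (x + m • (2 * Real.pi, (0 : ℂ)))
        (x + m • (2 * Real.pi, (0 : ℂ)) + n • ((0 : ℝ), 2 * Real.pi * Complex.I)),
      P.dev_zsmul (T.dev_polar_add_snd M), hM, one_zpow, mul_one,
      ← P.dev_add_zsmul (T.dev_polar_add_fst M) (x.1, 0) x m]
    congr 1
    ext <;> simp
  -- `Φ(z, w) ↦ Φ(z, 1)` is defined on the core as well. In the gauge `c`, `M` agrees on the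
  -- punctured tube with its pullback along `sec`, so it extends over the knot.
  let sec : C(Set.range T.toFun, ((Set.range K.toFun)ᶜ : Set ThreeSphere)) :=
    ⟨fun y => ⟨T.toFun ((T.coords y).1, 1), T.toFun_mem_compl_core one_ne_zero⟩,
      Continuous.subtype_mk (T.isOpenEmbedding.continuous.comp (by fun_prop)) _⟩
  let c : ((Set.range K.toFun)ᶜ : Set ThreeSphere) → G := fun y =>
    if h : ∃ x, T.polar x = y then P.dev (h.choose.1, 0) h.choose else 1
  have hc : ∀ x, c (T.polar x) = P.dev (x.1, 0) x := by
    intro x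
    have h : ∃ x', T.polar x' = T.polar x := ⟨x, rfl⟩
    simp only [c, dif_pos h]
    exact hradial _ _ h.choose_spec
  have key : ∀ (γ : C(I, ((Set.range K.toFun)ᶜ : Set ThreeSphere)))
      (hγ : ∀ t, (γ t : ThreeSphere) ∈ Set.range T.toFun),
      (M.gauge c).val γ = (M.comap sec).val ⟨fun t => ⟨γ t, hγ t⟩, by fun_prop⟩ := by
    intro γ hγ
    obtain ⟨Γ, rfl⟩ := T.exists_polar_lift γ hγ
    have h1 : (M.comap sec).val ⟨fun t => ⟨T.polar.comp Γ t, hγ t⟩,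
        Continuous.subtype_mk (continuous_subtype_val.comp (ContinuousMap.continuous _)) _⟩ =
        P.val ⟨fun t => ((Γ t).1, 0), by fun_prop⟩ := by
      simp only [hP, LocalSystem.comap_val]
      congr 1
      ext1 t
      refine Subtype.ext ?_
      change T.toFun ((T.coords _).1, 1) = T.toFun (Circle.exp (Γ t).1, Complex.exp 0)
      rw [T.coords_eq (x := (Circle.exp (Γ t).1, Complex.exp (Γ t).2)) rfl, Complex.exp_zero]
    refine Eq.trans ?_ h1.symm
    rw [LocalSystem.gauge_val, ← LocalSystem.comap_val, LocalSystem.val_eq_dev,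
      LocalSystem.val_eq_dev, ContinuousMap.comp_apply, ContinuousMap.comp_apply, hc, hc, P.inv_dev,
      P.dev_mul_dev, P.dev_mul_dev]
    rfl
  let U : Bool → Set ThreeSphere := fun b =>
    Bool.rec (Set.range T.toFun) (Set.range K.toFun)ᶜ b
  let N : ∀ b : Bool, LocalSystem (↥(U b)) G := fun
    | false => M.comap sec
    | true => M.gauge c
  let F : C(I, ThreeSphere) → G := fun γ =>
    if h : ∀ t, γ t ∈ (Set.range K.toFun)ᶜ then (M.gauge c).val ⟨fun t => ⟨γ t, h t⟩, by fun_prop⟩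
    else if h : ∀ t, γ t ∈ Set.range T.toFun then
      (M.comap sec).val ⟨fun t => ⟨γ t, h t⟩, by fun_prop⟩
    else 1
  have hKclosed : IsClosed (Set.range K.toFun) := by
    rw [T.range_core]
    exact T.isClosed_image (r := 0) (isClosed_eq continuous_snd continuous_const)
      fun x (hx : x.2 = 0) => by simp [hx]
  -- The extended functional lives on `S³`, where every loop contracts.
  have h := LocalSystem.val_eq_one_of_cover (U := U)
    (by rintro (_ | _); exacts [T.isOpenEmbedding.isOpen_range, hKclosed.isOpen_compl])
    (fun x => by
      by_cases hx : x ∈ Set.range K.toFun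
      · refine ⟨false, ?_⟩
        rw [T.range_core] at hx
        exact Set.image_subset_range _ _ hx
      · exact ⟨true, hx⟩)
    F N (by
      rintro (_ | _) γ
      · by_cases h : ∀ t, (γ t : ThreeSphere) ∈ (Set.range K.toFun)ᶜ
        · exact (dif_pos h).trans (key ⟨fun t => ⟨γ t, h t⟩, by fun_prop⟩ fun t => (γ t).2)
        · exact (dif_neg h).trans (dif_pos fun t => (γ t).2)
      · exact dif_pos fun t => (γ t).2) true γ (SimplyConnectedSpace.paths_homotopic _ _)
  change c (γ 0) * M.val γ.toContinuousMap * (c (γ 1))⁻¹ = 1 at h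
  rwa [γ.source, γ.target, conj_eq_one_iff] at h

end TubularNeighborhood

/-! ### Finite groups and the circle -/

theorem pow_eq_one_of_natCard_dvd {G : Type*} [Group G] {p : ℕ} (hG : Nat.card G ∣ p)
    (g : G) : g ^ p = 1 :=
  orderOf_dvd_iff_pow_eq_one.mp ((orderOf_dvd_natCard g).trans hG)

namespace LocalSystem

variable {X : Type*} [TopologicalSpace X] {G : Type*} [Group G]

theorem dev_comap_eq (L : LocalSystem X G) {E E' : Type*} [TopologicalSpace E]
    [TopologicalSpace E'] [SimplyConnectedSpace E] [SimplyConnectedSpace E'] {h : C(E, X)}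
    {h' : C(E', X)} (γ : C(I, E)) (γ' : C(I, E')) (hγ : ∀ t, h (γ t) = h' (γ' t)) :
    (L.comap h).dev (γ 0) (γ 1) = (L.comap h').dev (γ' 0) (γ' 1) := by
  rw [← val_eq_dev, ← val_eq_dev, comap_val, comap_val]
  exact congrArg L.val (ContinuousMap.ext hγ)

/-- On the circle, every local system takes values in a cyclic subgroup after a change of gauge. -/
theorem exists_gauge_circle (S : LocalSystem Circle G) :
    ∃ (g : G) (c : Circle → G), ∀ γ, (S.gauge c).val γ ∈ Subgroup.zpowers g := by
  have hper : ∀ x : ℝ, Circle.exp (x + 2 * Real.pi) = Circle.exp x := fun x => by simp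
  set P := S.comap Circle.exp
  have hP : ∀ a b, P.dev (a + 2 * Real.pi) (b + 2 * Real.pi) = P.dev a b :=
    dev_comap_add S Circle.exp hper
  refine ⟨P.dev 0 (0 + 2 * Real.pi), fun z => P.dev 0 (Complex.arg z), fun γ => ?_⟩
  obtain ⟨Γ, hΓ, -⟩ := Circle.isCoveringMap_exp.exists_path_lifts γ (Complex.arg (γ 0)) (by simp)
  have hval : S.val γ = P.dev (Γ 0) (Γ 1) := by
    rw [← P.val_eq_dev]
    exact congrArg S.val (ContinuousMap.ext fun t => (congrFun hΓ t).symm)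
  -- The gauge is transport from `0` to the principal argument; it differs from transport to `x` by
  -- a power of the monodromy.
  have harg : ∀ x : ℝ, P.dev 0 x * (P.dev 0 (Complex.arg (Circle.exp x)))⁻¹ ∈
      Subgroup.zpowers (P.dev 0 (0 + 2 * Real.pi)) := by
    intro x
    obtain ⟨n, hn⟩ := Circle.exists_eq_add_of_exp_eq
      (x := Complex.arg (Circle.exp x)) (y := x) (Circle.exp_arg _)
    refine ⟨n, ?_⟩
    change P.dev 0 (0 + 2 * Real.pi) ^ n = _
    rw [eq_mul_inv_iff_mul_eq, ← P.dev_zsmul hP,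
      ← P.dev_add_zsmul hP 0 (Complex.arg (Circle.exp x)) n, P.dev_mul_dev]
    congr 1
    rw [zsmul_eq_mul]
    exact hn.symm
  have h0 := harg (Γ 0)
  have h1 := harg (Γ 1)
  have e : ∀ t, Circle.exp (Γ t) = γ t := congrFun hΓ
  rw [e] at h0 h1
  rw [gauge_val, hval, ← P.dev_mul_dev (Γ 0) 0 (Γ 1), ← P.inv_dev 0 (Γ 0)]
  convert Subgroup.mul_mem _ (Subgroup.inv_mem _ h0) h1 using 1
  group

end LocalSystem

/-! ### The torus curve and its cone -/

namespace TubularNeighborhood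

/-- The cone over the `(p, q)`-torus knot in the solid torus `S¹ × ℂ`. -/
def torusCone (p : ℕ) (q : ℤ) : Set (Circle × ℂ) :=
  {x | x.2 ^ p = (‖x.2‖ : ℂ) ^ p * ((x.1 ^ q : Circle) : ℂ)}

theorem isClosed_torusCone (p : ℕ) (q : ℤ) : IsClosed (torusCone p q) := by
  refine isClosed_eq (by fun_prop) ?_
  exact Continuous.mul (by fun_prop)
    ((by fun_prop : Continuous fun z : Circle => (z : ℂ)).comp (continuous_fst.zpow q))

/-- The equation is homogeneous in `w`, so radial motion never enters or leaves the cone except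
through the core. -/
theorem mul_mem_torusCone_iff {p : ℕ} {q : ℤ} {r : ℝ} (hr : 0 < r) (z : Circle) (w : ℂ) :
    (z, (r : ℂ) * w) ∈ torusCone p q ↔ (z, w) ∈ torusCone p q := by
  have hr' : (r : ℂ) ^ p ≠ 0 := pow_ne_zero _ (by exact_mod_cast hr.ne')
  simp only [torusCone, Set.mem_ofPred_eq, norm_mul, Complex.norm_real,
    Real.norm_of_nonneg hr.le, Complex.ofReal_mul, mul_pow, mul_assoc]
  exact mul_right_inj' hr'

theorem zero_mem_torusCone {p : ℕ} (hp : 0 < p) (q : ℤ) (z : Circle) :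
    (z, 0) ∈ torusCone p q := by
  simp [torusCone, hp.ne']

theorem exp_mem_torusCone_iff (p : ℕ) (q : ℤ) (θ : ℝ) (ζ : ℂ) :
    (Circle.exp θ, Complex.exp ζ) ∈ torusCone p q ↔
      ∃ n : ℤ, p * ζ.im - q * θ = n * (2 * Real.pi) := by
  have h1 : Complex.exp ζ ^ p = Complex.exp (p * ζ) := (Complex.exp_nat_mul ζ p).symm
  have h2 : ((‖Complex.exp ζ‖ : ℝ) : ℂ) ^ p * ((Circle.exp θ ^ q : Circle) : ℂ) =
      Complex.exp (p * (ζ.re : ℂ) + q * (θ * Complex.I)) := by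
    rw [Complex.exp_add, Complex.exp_nat_mul, Complex.exp_int_mul, Complex.norm_exp]
    simp
  simp only [torusCone, Set.mem_ofPred_eq, h1, h2, Complex.exp_eq_exp_iff_exists_int]
  refine exists_congr fun n => ?_
  rw [Complex.ext_iff]
  simp only [Complex.mul_re, Complex.mul_im, Complex.add_re, Complex.add_im, Complex.natCast_re,
    Complex.natCast_im, Complex.intCast_re, Complex.intCast_im, Complex.ofReal_re,
    Complex.ofReal_im, Complex.I_re, Complex.I_im, Complex.re_ofNat, Complex.im_ofNat]
  constructor
  · rintro ⟨-, h⟩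
    linarith
  · intro h
    constructor <;> linarith

variable {K : Knot} (T : TubularNeighborhood K) {p : ℕ} {q : ℤ}

theorem range_torusCurve (hpq : IsCoprime (p : ℤ) q) :
    Set.range (T.torusCurve p q) = T.toFun '' {x | ‖x.2‖ = 1 ∧ x ∈ torusCone p q} := by
  ext y
  constructor
  · rintro ⟨z, rfl⟩
    refine ⟨(z ^ p, ((z ^ q : Circle) : ℂ)), ⟨Circle.norm_coe _, ?_⟩, rfl⟩
    simp only [torusCone, Set.mem_ofPred_eq, Circle.norm_coe, Complex.ofReal_one, one_pow, one_mul]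
    rw [← Circle.coe_pow, ← zpow_natCast, ← zpow_natCast, ← zpow_mul, ← zpow_mul, mul_comm]
  · rintro ⟨⟨z, w⟩, ⟨hw, hc⟩, rfl⟩
    simp only at hw
    obtain ⟨u, rfl⟩ : ∃ u : Circle, (u : ℂ) = w :=
      ⟨⟨w, mem_sphere_zero_iff_norm.mpr hw⟩, rfl⟩
    simp only [torusCone, Set.mem_ofPred_eq, Circle.norm_coe, Complex.ofReal_one, one_pow,
      one_mul] at hc
    rw [← Circle.coe_pow, Circle.coe_inj, ← zpow_natCast] at hc
    obtain ⟨a, b, hab⟩ := hpq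
    -- Bézout: with `u ^ p = z ^ q` and `a p + b q = 1`, this is the common parameter.
    refine ⟨z ^ a * u ^ b, ?_⟩
    have h1 : (z ^ a * u ^ b) ^ (p : ℤ) = z := by
      rw [mul_zpow, ← zpow_mul, ← zpow_mul, mul_comm b, zpow_mul u, hc, ← zpow_mul, ← zpow_add,
        mul_comm q b, hab, zpow_one]
    have h2 : (z ^ a * u ^ b) ^ q = u := by
      rw [mul_zpow, ← zpow_mul, ← zpow_mul, mul_comm a, zpow_mul z, ← hc, ← zpow_mul, ← zpow_add,
        mul_comm (p : ℤ) a, hab, zpow_one]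
    rw [zpow_natCast] at h1
    simp only [torusCurve, h1, h2]

/-- The complement of the torus curve. -/
abbrev cableComplement (p : ℕ) (q : ℤ) : Set ThreeSphere := (Set.range (T.torusCurve p q))ᶜ

theorem toFun_mem_cableComplement (hpq : IsCoprime (p : ℤ) q) {x : Circle × ℂ}
    (hx : ‖x.2‖ = 1 → x ∉ torusCone p q) : T.toFun x ∈ T.cableComplement p q := by
  rw [cableComplement, T.range_torusCurve hpq]
  rintro ⟨x', ⟨h1, h2⟩, h⟩
  rw [T.toFun_inj] at h
  subst h
  exact hx h1 h2

theorem push_mem_cableComplement (p : ℕ) (q : ℤ) {y : ThreeSphere}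
    (hy : y ∈ (Set.range K.toFun)ᶜ) : T.push 2 (1, y) ∈ T.cableComplement p q := by
  rintro ⟨z, h⟩
  refine T.push_one_notMem (s := 2) hy ⟨(z ^ p, ((z ^ q : Circle) : ℂ)), ?_, h⟩
  exact (Circle.norm_coe (z ^ q)).trans_lt one_lt_two

/-- Pushing the complement of the core out to radius `2` avoids the torus curve. -/
def pushOut (p : ℕ) (q : ℤ) :
    C(((Set.range K.toFun)ᶜ : Set ThreeSphere), T.cableComplement p q) where
  toFun y := ⟨T.push 2 (1, y), T.push_mem_cableComplement p q y.2⟩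
  continuous_toFun := Continuous.subtype_mk
    (T.continuous_push two_pos continuous_const continuous_subtype_val fun y => y.2) _

theorem pushOut_polar (x : ℝ × ℂ) (hx : 2 ≤ Real.exp x.2.re) :
    (T.pushOut p q (T.polar x) : ThreeSphere) = T.toFun (Circle.exp x.1, Complex.exp x.2) := by
  refine T.push_of_notMem_image two_pos 1 ?_
  rintro ⟨x', hx', h⟩
  have h' := T.toFun_inj.mp h
  subst h'
  simp only [Set.mem_ofPred_eq, Complex.norm_exp] at hx'
  linarith

/-- The core of the solid torus, in the complement of the torus curve. -/
def coreMap (hpq : IsCoprime (p : ℤ) q) : C(Circle, T.cableComplement p q) where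
  toFun z := ⟨T.toFun (z, 0), T.toFun_mem_cableComplement hpq (by simp)⟩
  continuous_toFun := Continuous.subtype_mk (T.isOpenEmbedding.continuous.comp (by fun_prop)) _

/-- The angular shift `π / p` makes `p ζ.im - q θ` equal to `π`, off the cone. The radius `2 r ^ 2`
is nonnegative for all real `r`, is `0` on the core and reaches `2`, where `pushOut` is the
identity, at `r = 1`. -/
theorem parallel_mem_cableComplement (hp : 0 < p) (hpq : IsCoprime (p : ℤ) q) (r s : ℝ) :
    T.toFun (Circle.exp (p * s),
      ((2 * r ^ 2 : ℝ) : ℂ) * Complex.exp (((Real.pi / p + q * s : ℝ) : ℂ) * Complex.I)) ∈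
      T.cableComplement p q := by
  refine T.toFun_mem_cableComplement hpq fun h1 h2 => ?_
  have hr : 0 < 2 * r ^ 2 := by
    rcases (by positivity : 0 ≤ 2 * r ^ 2).eq_or_lt with h | h
    · rw [← h] at h1
      simp at h1
    · exact h
  rw [mul_mem_torusCone_iff hr, exp_mem_torusCone_iff] at h2
  obtain ⟨n, hn⟩ := h2
  have hp' : (p : ℝ) ≠ 0 := by exact_mod_cast hp.ne'
  have him : (((Real.pi / p + q * s : ℝ) : ℂ) * Complex.I).im = Real.pi / p + q * s := by simp
  rw [him] at hn
  have h3 : 1 * Real.pi = n * 2 * Real.pi := by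
    rw [mul_assoc, ← hn]
    field_simp
    ring
  have h4 : (1 : ℤ) = n * 2 := by exact_mod_cast mul_right_cancel₀ Real.pi_pos.ne' h3
  omega

/-- A family of parallels of the torus curve, contracting to the core traversed `p` times. -/
def parallels (hp : 0 < p) (hpq : IsCoprime (p : ℤ) q) : C(ℝ × ℝ, T.cableComplement p q) where
  toFun x := ⟨_, T.parallel_mem_cableComplement hp hpq x.1 x.2⟩
  continuous_toFun := Continuous.subtype_mk (T.isOpenEmbedding.continuous.comp (by fun_prop)) _

variable {G : Type*} [Group G]

/-- If the order of `G` divides `p`, then the meridian of the companion acts trivially. -/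
theorem dev_meridian_eq_one (hp : 0 < p) (hpq : IsCoprime (p : ℤ) q) (hG : Nat.card G ∣ p)
    (L : LocalSystem (T.cableComplement p q) G) (b : ℝ × ℂ) :
    ((L.comap (T.pushOut p q)).comap T.polar).dev b (b + (0, 2 * Real.pi * Complex.I)) = 1 := by
  set P := (L.comap (T.pushOut p q)).comap T.polar
  have he1 := T.dev_polar_add_fst (L.comap (T.pushOut p q))
  have he2 := T.dev_polar_add_snd (L.comap (T.pushOut p q))
  change ∀ a b, P.dev _ _ = P.dev _ _ at he1
  change ∀ a b, P.dev _ _ = P.dev _ _ at he2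
  set e₁ : ℝ × ℂ := (2 * Real.pi, 0) with hdef1
  set e₂ : ℝ × ℂ := (0, 2 * Real.pi * Complex.I) with hdef2
  -- The point of radius `2` and angle `π / p`, where the outermost parallel starts.
  let a : ℝ × ℂ := (0, Real.log 2 + (Real.pi / p : ℝ) * Complex.I)
  have hcore : ((L.comap (T.coreMap hpq)).comap Circle.exp).dev 0 (0 + p • (2 * Real.pi)) = 1 := by
    rw [LocalSystem.dev_nsmul _ (LocalSystem.dev_comap_add _ Circle.exp fun x => by simp),
      pow_eq_one_of_natCard_dvd hG]
  set D := L.comap (T.parallels hp hpq) with hD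
  have hD0 : D.dev (0, 0) (0, 2 * Real.pi) = 1 := by
    rw [← hcore]
    have := L.dev_comap_eq (h := T.parallels hp hpq) (h' := (T.coreMap hpq).comp Circle.exp)
      ⟨fun t : I => ((0 : ℝ), (t : ℝ) * (2 * Real.pi)), by fun_prop⟩
      ⟨fun t : I => (t : ℝ) * (p * (2 * Real.pi)), by fun_prop⟩ (fun t => Subtype.ext (by
        simp only [parallels, coreMap, ContinuousMap.coe_mk, ContinuousMap.comp_apply]
        congr 2
        · congr 1; ring
        · simp))
    simp only [ContinuousMap.coe_mk, Set.Icc.coe_zero, Set.Icc.coe_one, zero_mul, one_mul] at this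
    rw [nsmul_eq_mul, zero_add]
    exact this
  have hDper : D.dev (0, 2 * Real.pi) (1, 2 * Real.pi) = D.dev (0, 0) (1, 0) := by
    have h := LocalSystem.dev_comap_add L (T.parallels hp hpq) (v := ((0 : ℝ), 2 * Real.pi))
      (fun x => Subtype.ext (by
        simp only [parallels, ContinuousMap.coe_mk, Prod.fst_add, Prod.snd_add, add_zero]
        congr 2
        · rw [mul_add, ← nsmul_eq_mul p (2 * Real.pi), Circle.periodic_exp.nsmul p]
        · congr 1
          rw [Complex.exp_eq_exp_iff_exists_int]
          exact ⟨q, by push_cast; ring⟩)) (0, 0) (1, 0)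
    simpa using h
  -- The two sides of the homotopy have equal transport and the inner end is trivial, so the outer
  -- end is trivial too.
  have hD1 : D.dev (1, 0) (1, 2 * Real.pi) = 1 := by
    rw [← D.dev_mul_dev (1, 0) (0, 0), ← D.dev_mul_dev (0, 0) (0, 2 * Real.pi), hD0, hDper, one_mul,
      D.dev_mul_dev, D.dev_self]
  -- Seen from outside, the outermost parallel is `p` longitudes and `q` meridians.
  have hav : P.dev a (a + p • e₁ + q • e₂) = 1 := by
    rw [← hD1]
    have := L.dev_comap_eq (h := (T.pushOut p q).comp T.polar) (h' := T.parallels hp hpq)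
      ⟨fun t : I => ((t : ℝ) * (p * (2 * Real.pi)), (Real.log 2 : ℂ) +
        ((Real.pi / p + q * (t * (2 * Real.pi)) : ℝ) : ℂ) * Complex.I), by fun_prop⟩
      ⟨fun t : I => ((1 : ℝ), (t : ℝ) * (2 * Real.pi)), by fun_prop⟩ (fun t => Subtype.ext (by
        rw [ContinuousMap.comp_apply, T.pushOut_polar]
        · simp only [parallels, ContinuousMap.coe_mk]
          congr 2
          · congr 1; ring
          · rw [Complex.exp_add, ← Complex.ofReal_exp, Real.exp_log two_pos]
            norm_num
        · simp only [ContinuousMap.coe_mk, Complex.add_re, Complex.ofReal_re,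
            Complex.re_ofReal_mul, Complex.I_re, mul_zero, add_zero, Real.exp_log two_pos, le_refl]))
    simp only [ContinuousMap.coe_mk, Set.Icc.coe_zero, Set.Icc.coe_one, zero_mul, one_mul] at this
    rw [← this]
    change P.dev _ _ = P.dev _ _
    congr 1
    · ext <;> simp [a]
    · ext1
      · simp [a, hdef1, hdef2]
      · rw [Prod.snd_add, Prod.snd_add, Prod.smul_snd, Prod.smul_snd]
        simp only [a, hdef1, hdef2, nsmul_zero, zsmul_eq_mul]
        push_cast
        ring
  have hcomm : Commute (P.dev a (a + e₁)) (P.dev a (a + e₂)) := by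
    have h1 : P.dev a (a + e₁) * P.dev a (a + e₂) = P.dev a (a + e₁ + e₂) := by
      rw [← he1 a (a + e₂), add_right_comm, P.dev_mul_dev]
    have h2 : P.dev a (a + e₂) * P.dev a (a + e₁) = P.dev a (a + e₁ + e₂) := by
      rw [← he2 a (a + e₁), P.dev_mul_dev]
    exact h1.trans h2.symm
  have hq : P.dev a (a + e₂) ^ q = 1 := by
    rw [← P.dev_mul_dev a (a + p • e₁), P.dev_nsmul he1, pow_eq_one_of_natCard_dvd hG, one_mul,
      P.dev_zsmul he2, add_right_comm, P.dev_add_nsmul he1] at hav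
    exact hav
  have ha : P.dev a (a + e₂) = 1 := by
    obtain ⟨u, v, huv⟩ := hpq
    rw [← zpow_one (P.dev a (a + e₂)), ← huv, zpow_add, mul_comm u, mul_comm v, zpow_mul, zpow_mul,
      hq, zpow_natCast, pow_eq_one_of_natCard_dvd hG]
    simp
  rw [← P.dev_mul_dev b a, ← P.dev_mul_dev a (a + e₂), ha, one_mul, he2, P.dev_mul_dev, P.dev_self]

end TubularNeighborhood

/-! ### The two pieces of the cable complement -/

namespace TubularNeighborhood

variable {K : Knot} (T : TubularNeighborhood K) {p : ℕ} {q : ℤ} {G : Type*} [Group G]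

/-- The complement of the inner part of the cone over the torus curve. -/
def outerPiece (p : ℕ) (q : ℤ) : Set (T.cableComplement p q) :=
  {y | (y : ThreeSphere) ∉ T.toFun '' {x | ‖x.2‖ ≤ 1 ∧ x ∈ torusCone p q}}

/-- The tubular neighbourhood without the outer part of the cone over the torus curve. -/
def innerPiece (p : ℕ) (q : ℤ) : Set (T.cableComplement p q) :=
  {y | (y : ThreeSphere) ∈ T.toFun '' {x | ‖x.2‖ < 1 ∨ x ∉ torusCone p q}}

theorem isOpen_outerPiece : IsOpen (T.outerPiece p q) := by
  have h1 : IsClosed {x : Circle × ℂ | ‖x.2‖ ≤ 1} := isClosed_le (by fun_prop) continuous_const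
  have h : IsClosed (T.toFun '' {x | ‖x.2‖ ≤ 1 ∧ x ∈ torusCone p q}) :=
    T.isClosed_image (h1.inter (isClosed_torusCone p q))
      fun x hx => hx.1
  exact h.isOpen_compl.preimage continuous_subtype_val

theorem isOpen_innerPiece : IsOpen (T.innerPiece p q) := by
  have h1 : IsOpen {x : Circle × ℂ | ‖x.2‖ < 1} := isOpen_lt (by fun_prop) continuous_const
  have h : IsOpen {x : Circle × ℂ | ‖x.2‖ < 1 ∨ x ∉ torusCone p q} :=
    h1.union (isClosed_torusCone p q).isOpen_compl
  exact (T.isOpenEmbedding.isOpenMap _ h).preimage continuous_subtype_val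

theorem mem_outerPiece_or_mem_innerPiece (hpq : IsCoprime (p : ℤ) q)
    (y : T.cableComplement p q) : y ∈ T.outerPiece p q ∨ y ∈ T.innerPiece p q := by
  rw [or_iff_not_imp_left]
  intro h
  obtain ⟨x, ⟨h1, h2⟩, hx⟩ := not_not.mp h
  refine ⟨x, .inl (lt_of_le_of_ne h1 fun h3 => ?_), hx⟩
  have hy : (y : ThreeSphere) ∉ Set.range (T.torusCurve p q) := y.2
  rw [T.range_torusCurve hpq] at hy
  exact hy ⟨x, ⟨h3, h2⟩, hx⟩

/-- One piece omits the inner part of the cone, the other the outer part, so the overlap is the tube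
minus the whole cone: the thickened annulus. -/
theorem outerPiece_inter_innerPiece : T.outerPiece p q ∩ T.innerPiece p q =
    {y : T.cableComplement p q | (y : ThreeSphere) ∈ T.toFun '' (torusCone p q)ᶜ} := by
  ext y
  constructor
  · rintro ⟨h1, x, h2, hx⟩
    refine ⟨x, fun h3 => h1 ⟨x, ⟨?_, h3⟩, hx⟩, hx⟩
    exact (h2.resolve_right fun h => h h3).le
  · rintro ⟨x, h, hx⟩
    refine ⟨?_, x, .inr h, hx⟩
    rintro ⟨x', ⟨-, h'⟩, hx'⟩
    rw [← hx, T.toFun_inj] at hx'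
    exact h (hx' ▸ h')

/-- Every point off the cone has polar coordinates in a fundamental strip. -/
theorem exists_exp_eq_of_notMem_torusCone (hp : 0 < p) (hpq : IsCoprime (p : ℤ) q)
    {x : Circle × ℂ} (hx : x ∉ torusCone p q) : ∃ (θ : ℝ) (ζ : ℂ),
      (Circle.exp θ, Complex.exp ζ) = x ∧ p * ζ.im - q * θ ∈ Set.Ioo 0 (2 * Real.pi) := by
  obtain ⟨z, w⟩ := x
  have hw : w ≠ 0 := by
    rintro rfl
    exact hx (zero_mem_torusCone hp q z)
  obtain ⟨u, v, huv⟩ := hpq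
  have hpi := Real.two_pi_pos
  set θ := Complex.arg z
  set ζ := Complex.log w
  set N := ⌊(p * ζ.im - q * θ) / (2 * Real.pi)⌋
  -- With `u p + v q = 1`, shifting the angles by `N v` and `-N u` turns lowers `p ζ.im - q θ` by
  -- exactly `N` turns.
  have e1 : Circle.exp (θ + (N * v : ℤ) * (2 * Real.pi)) = z := by
    rw [← zsmul_eq_mul, Circle.periodic_exp.zsmul]
    simp [θ]
  have e2 : Complex.exp (ζ + (-N * u : ℤ) * (2 * Real.pi * Complex.I)) = w := by
    rw [← zsmul_eq_mul, Complex.exp_periodic.zsmul, Complex.exp_log hw]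
  refine ⟨_, _, Prod.ext e1 e2, ?_⟩
  have huv' : (u : ℝ) * p + v * q = 1 := by exact_mod_cast huv
  have him : (ζ + (-N * u : ℤ) * (2 * Real.pi * Complex.I)).im =
      ζ.im - N * u * (2 * Real.pi) := by
    simp
    ring
  have hval : p * (ζ + (-N * u : ℤ) * (2 * Real.pi * Complex.I)).im -
      q * (θ + (N * v : ℤ) * (2 * Real.pi)) = (p * ζ.im - q * θ) - N * (2 * Real.pi) := by
    rw [him]
    push_cast
    linear_combination (-N * (2 * Real.pi)) * huv'
  have hfl := Int.floor_le ((p * ζ.im - q * θ) / (2 * Real.pi))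
  have hfu := Int.lt_floor_add_one ((p * ζ.im - q * θ) / (2 * Real.pi))
  rw [le_div_iff₀ hpi] at hfl
  rw [div_lt_iff₀ hpi] at hfu
  constructor
  · rw [hval]
    refine lt_of_le_of_ne (by linarith) fun h => hx ?_
    rw [← e1, ← e2, exp_mem_torusCone_iff]
    exact ⟨0, by rw [hval, ← h]; simp⟩
  · rw [hval]
    linarith

theorem exp_notMem_torusCone {θ : ℝ} {ζ : ℂ}
    (h : p * ζ.im - q * θ ∈ Set.Ioo 0 (2 * Real.pi)) :
    (Circle.exp θ, Complex.exp ζ) ∉ torusCone p q := by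
  rw [exp_mem_torusCone_iff]
  rintro ⟨n, hn⟩
  have hpi := Real.two_pi_pos
  rw [hn] at h
  have h0 : (0 : ℝ) < n := by
    by_contra! h'
    nlinarith [h.1]
  have h1 : (n : ℝ) < 1 := by
    by_contra! h'
    nlinarith [h.2]
  have h0' : (0 : ℤ) < n := by exact_mod_cast h0
  have h1' : n < (1 : ℤ) := by exact_mod_cast h1
  omega

/-- The overlap is the continuous image of a convex strip in polar coordinates. -/
theorem isPathConnected_inter (hp : 0 < p) (hpq : IsCoprime (p : ℤ) q) :
    IsPathConnected (T.outerPiece p q ∩ T.innerPiece p q) := by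
  let S : Set (ℝ × ℂ) := {x | p * x.2.im - q * x.1 ∈ Set.Ioo 0 (2 * Real.pi)}
  have hS : IsPathConnected S := by
    refine Convex.isPathConnected ?_ ⟨(0, (Real.pi / p : ℝ) * Complex.I), ?_⟩
    · let l : ℝ × ℂ →ₗ[ℝ] ℝ := (p : ℝ) • (Complex.imLm ∘ₗ LinearMap.snd ℝ ℝ ℂ) -
        (q : ℝ) • LinearMap.fst ℝ ℝ ℂ
      exact (convex_Ioo (0 : ℝ) (2 * Real.pi)).linear_preimage l
    · have hp' : (p : ℝ) ≠ 0 := by exact_mod_cast hp.ne'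
      have h : (p : ℝ) * (((Real.pi / p : ℝ) : ℂ) * Complex.I).im - q * 0 = Real.pi := by
        rw [Complex.im_ofReal_mul, Complex.I_im]
        field_simp
        ring
      change _ ∈ Set.Ioo _ _
      rw [h]
      exact ⟨Real.pi_pos, by linarith [Real.pi_pos]⟩
  have := isPathConnected_iff_pathConnectedSpace.mp hS
  let f : S → T.cableComplement p q := fun x => ⟨T.polar x,
    T.toFun_mem_cableComplement hpq fun _ => exp_notMem_torusCone x.2⟩
  have hf : Continuous f := Continuous.subtype_mk
    (continuous_subtype_val.comp (T.polar.continuous.comp continuous_subtype_val)) _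
  have himg : T.outerPiece p q ∩ T.innerPiece p q = Set.range f := by
    rw [outerPiece_inter_innerPiece]
    ext y
    constructor
    · rintro ⟨x, hx, hxy⟩
      obtain ⟨θ, ζ, rfl, h⟩ := exists_exp_eq_of_notMem_torusCone hp hpq hx
      exact ⟨⟨(θ, ζ), h⟩, Subtype.ext hxy⟩
    · rintro ⟨x, rfl⟩
      exact ⟨_, exp_notMem_torusCone x.2, rfl⟩
  rw [himg]
  exact isPathConnected_range hf

theorem outerPiece_subset_compl_core (hp : 0 < p) {y : T.cableComplement p q}
    (hy : y ∈ T.outerPiece p q) : (y : ThreeSphere) ∈ (Set.range K.toFun)ᶜ := by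
  rintro ⟨z, hz⟩
  exact hy ⟨(z, 0), ⟨by simp, zero_mem_torusCone hp q z⟩, (T.core z).trans hz⟩

/-- Pushing moves outwards along rays, so it could meet the torus curve only from a point of the
cone with radius at most `1`, which the outer piece omits. -/
theorem push_mem_of_mem_outerPiece (hp : 0 < p) (hpq : IsCoprime (p : ℤ) q)
    {y : T.cableComplement p q} (hy : y ∈ T.outerPiece p q) {t : ℝ} (ht : 0 ≤ t) :
    T.push 2 (t, y) ∈ T.cableComplement p q := by
  by_cases hr : (y : ThreeSphere) ∈ Set.range T.toFun
  · obtain ⟨z, w, hw, hzw⟩ := T.exists_toFun_eq (T.outerPiece_subset_compl_core hp hy) hr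
    rw [← hzw, push_toFun]
    have h1 : 1 ≤ 1 - t + t * max 1 (2 / ‖w‖) := by
      nlinarith [le_max_left 1 (2 / ‖w‖)]
    refine T.toFun_mem_cableComplement hpq fun hn hc => hy ⟨(z, w), ⟨?_, ?_⟩, hzw⟩
    · simp only [norm_mul, Complex.norm_real, Real.norm_of_nonneg (zero_le_one.trans h1)] at hn
      change ‖w‖ ≤ 1
      nlinarith [norm_nonneg w]
    · exact (mul_mem_torusCone_iff (zero_lt_one.trans_le h1) z w).mp hc
  · rw [T.push_of_notMem 2 t hr]
    exact y.2

theorem contract_mem_of_mem (hpq : IsCoprime (p : ℤ) q) {x : Circle × ℂ}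
    (hx : ‖x.2‖ < 1 ∨ x ∉ torusCone p q) {r : ℝ} (h0 : 0 ≤ r) (h1 : r ≤ 1) :
    T.toFun (x.1, (r : ℂ) * x.2) ∈ T.cableComplement p q := by
  refine T.toFun_mem_cableComplement hpq fun hn hc => ?_
  simp only [norm_mul, Complex.norm_real, Real.norm_of_nonneg h0] at hn
  have hr : 0 < r := h0.lt_of_ne (by rintro rfl; simp at hn)
  rcases hx with hx | hx
  · nlinarith [norm_nonneg x.2]
  · exact hx ((mul_mem_torusCone_iff hr x.1 x.2).mp hc)

/-- If the order of `G` divides `p`, then a local system on the complement of the torus curve is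
trivial on the outer piece. -/
theorem exists_gauge_outerPiece (hp : 0 < p) (hpq : IsCoprime (p : ℤ) q) (hG : Nat.card G ∣ p)
    (L : LocalSystem (T.cableComplement p q) G) :
    ∃ c : T.cableComplement p q → G, ∀ γ : C(I, T.cableComplement p q),
      (∀ t, γ t ∈ T.outerPiece p q) → c (γ 0) * L.val γ * (c (γ 1))⁻¹ ∈ (⊥ : Subgroup G) := by
  obtain ⟨c, hc⟩ := (L.comap (T.pushOut p q)).exists_gauge fun a γ =>
    T.val_loop_eq_one_of_meridian _ (T.dev_meridian_eq_one hp hpq hG L) γ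
  let j : C(T.outerPiece p q, ((Set.range K.toFun)ᶜ : Set ThreeSphere)) :=
    ⟨fun y => ⟨y, T.outerPiece_subset_compl_core hp y.2⟩, by fun_prop⟩
  let H : ContinuousMap.Homotopy (⟨Subtype.val, continuous_subtype_val⟩ :
      C(T.outerPiece p q, T.cableComplement p q)) ((T.pushOut p q).comp j) :=
    { toFun := fun x => ⟨T.push 2 ((x.1 : ℝ), x.2),
        T.push_mem_of_mem_outerPiece hp hpq x.2.2 x.1.2.1⟩
      continuous_toFun := Continuous.subtype_mk (T.continuous_push two_pos (by fun_prop)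
        (by fun_prop) fun x => T.outerPiece_subset_compl_core hp x.2.2) _
      map_zero_left := fun y => Subtype.ext (T.push_zero 2 _)
      map_one_left := fun y => rfl }
  -- The gauge on the knot complement is pulled back through the push and corrected by the values of
  -- the homotopy tracks.
  refine L.exists_gauge_of_restrict ⊥
    (fun y => c (j y) * (L.val (H.evalAt y).toContinuousMap)⁻¹) fun γ => ?_
  have h := hc (j.comp γ)
  rw [Subgroup.mem_bot, ← h, LocalSystem.gauge_val, LocalSystem.comap_val,
    L.val_comp_of_homotopy H, LocalSystem.comap_val]
  simp only [ContinuousMap.comp_apply, ContinuousMap.comp_assoc]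
  group

/-- A local system on the complement of the torus curve is cyclic on the inner piece. -/
theorem exists_gauge_innerPiece (hpq : IsCoprime (p : ℤ) q)
    (L : LocalSystem (T.cableComplement p q) G) :
    ∃ (g : G) (c : T.cableComplement p q → G), ∀ γ : C(I, T.cableComplement p q),
      (∀ t, γ t ∈ T.innerPiece p q) → c (γ 0) * L.val γ * (c (γ 1))⁻¹ ∈ Subgroup.zpowers g := by
  obtain ⟨g, c, hc⟩ := (L.comap (T.coreMap hpq)).exists_gauge_circle
  let j : C(T.innerPiece p q, Circle × ℂ) :=
    T.coords.comp ⟨fun y => ⟨y, Set.image_subset_range _ _ y.2⟩, by fun_prop⟩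
  have hj : ∀ y : T.innerPiece p q, T.toFun (j y) = y := fun y => T.toFun_coords _
  have hj' : ∀ y : T.innerPiece p q, ‖(j y).2‖ < 1 ∨ j y ∉ torusCone p q := by
    intro y
    obtain ⟨x, hx, hxy⟩ := y.2
    rw [← hj, T.toFun_inj] at hxy
    exact hxy ▸ hx
  let j₁ : C(T.innerPiece p q, Circle) := ⟨fun y => (j y).1, by fun_prop⟩
  let H : ContinuousMap.Homotopy (⟨Subtype.val, continuous_subtype_val⟩ :
      C(T.innerPiece p q, T.cableComplement p q)) ((T.coreMap hpq).comp j₁) :=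
    { toFun := fun x => ⟨T.toFun ((j x.2).1, ((1 - x.1 : ℝ) : ℂ) * (j x.2).2),
        T.contract_mem_of_mem hpq (hj' x.2) (sub_nonneg.mpr x.1.2.2) (by linarith [x.1.2.1])⟩
      continuous_toFun := Continuous.subtype_mk
        (T.isOpenEmbedding.continuous.comp (by fun_prop)) _
      map_zero_left := fun y => Subtype.ext (by simpa using hj y)
      map_one_left := fun y => Subtype.ext (by simp [coreMap, j₁]) }
  refine ⟨g, L.exists_gauge_of_restrict _
    (fun y => c (j₁ y) * (L.val (H.evalAt y).toContinuousMap)⁻¹) fun γ => ?_⟩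
  convert hc (j₁.comp γ) using 1
  rw [LocalSystem.gauge_val, LocalSystem.comap_val,
    L.val_comp_of_homotopy H, LocalSystem.gauge_val, LocalSystem.comap_val]
  simp only [ContinuousMap.comp_apply, ContinuousMap.comp_assoc]
  group

/-- If the order of `G` divides `p`, then every `G`-valued local system on the complement of the
torus curve is cyclic. -/
theorem exists_gauge_cableComplement (hp : 0 < p) (hpq : IsCoprime (p : ℤ) q)
    (hG : Nat.card G ∣ p) (L : LocalSystem (T.cableComplement p q) G) :
    ∃ (g : G) (c : T.cableComplement p q → G), ∀ γ : C(I, T.cableComplement p q),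
      c (γ 0) * L.val γ * (c (γ 1))⁻¹ ∈ Subgroup.zpowers g := by
  obtain ⟨cA, hcA⟩ := T.exists_gauge_outerPiece hp hpq hG L
  obtain ⟨g, cB, hcB⟩ := T.exists_gauge_innerPiece hpq L
  exact ⟨g, L.exists_gauge_of_union T.isOpen_outerPiece T.isOpen_innerPiece
    (T.mem_outerPiece_or_mem_innerPiece hpq) (T.isPathConnected_inter hp hpq) _ hcA hcB⟩

end TubularNeighborhood

/-! ### From local systems back to the knot group -/

/-- A homomorphism from the fundamental group whose local system is, up to gauge, cyclic has
cyclic image. -/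
theorem LocalSystem.isCyclic_range {X : Type*} [TopologicalSpace X] {G : Type*} [Group G] {x : X}
    (f : FundamentalGroup X x →* G) {g k : G}
    (h : ∀ γ : Path x x, k * (LocalSystem.ofHom f).val γ.toContinuousMap * k⁻¹ ∈
      Subgroup.zpowers g) : IsCyclic f.range := by
  obtain ⟨k', hk'⟩ := LocalSystem.exists_ofHom_val f
  have hle : f.range ≤ Subgroup.zpowers ((k * k')⁻¹ * g * (k * k')) := by
    rintro _ ⟨a, rfl⟩
    obtain ⟨γ, rfl⟩ := Path.Homotopic.Quotient.mk_surjective a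
    obtain ⟨n, hn⟩ := h γ
    change g ^ n = _ at hn
    -- The sign undoes the inverse built into `LocalSystem.ofHom`.
    refine ⟨-n, ?_⟩
    rw [hk'] at hn
    have h1 := conj_zpow (i := -n) (a := (k * k')⁻¹) (b := g)
    rw [inv_inv] at h1
    change ((k * k')⁻¹ * g * (k * k')) ^ (-n) = _
    rw [h1, zpow_neg, hn]
    group
  exact isCyclic_of_injective (Subgroup.inclusion hle) (Subgroup.inclusion_injective hle)

end

theorem mainTheorem8 (p : ℕ) (hp : 0 < p) (q : ℤ) (hpq : IsCoprime (p : ℤ) q)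
    (K J : Knot) (hJ : K.IsCable p q J)
    (T : TubularNeighborhood J) (x : T.exterior)
    {G : Type*} [Group G] [Finite G] (hG : Nat.card G ∣ p)
    (f : T.knotGroup x →* G) : IsCyclic f.range := by
  obtain ⟨T₀, -, H, -, -, hH⟩ := hJ
  let e : ThreeSphere ≃ₜ ThreeSphere := (H 1).toHomeomorph
  have he : ∀ z, e (T₀.torusCurve p q z) = J.toFun z := hH
  let h : C(T₀.cableComplement p q, ((Set.range J.toFun)ᶜ : Set ThreeSphere)) :=
    ⟨fun y => ⟨e y, by
      rintro ⟨z, hz⟩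
      rw [← he] at hz
      exact y.2 ⟨z, e.injective hz⟩⟩, by fun_prop⟩
  have hmem : ∀ y : T.exterior, e.symm y ∈ T₀.cableComplement p q := by
    rintro y ⟨z, hz⟩
    refine T.exterior_subset y.2 ⟨z, ?_⟩
    rw [← he, hz, e.apply_symm_apply]
  let i : C(T.exterior, T₀.cableComplement p q) := ⟨fun y => ⟨e.symm y, hmem y⟩, by fun_prop⟩
  -- The exterior of `J` is a retract of the complement of the torus curve, so the local system of
  -- `f` pulls back there and is recovered on loops of the exterior.
  have hri : ∀ y, T.retraction (h (i y)) = y := fun y => by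
    have hy : ((h (i y) : ((Set.range J.toFun)ᶜ : Set ThreeSphere)) : ThreeSphere) = y :=
      e.apply_symm_apply y
    rw [T.retraction_of_mem_exterior _ (by rw [hy]; exact y.2)]
    exact Subtype.ext hy
  obtain ⟨g, c, hc⟩ := T₀.exists_gauge_cableComplement hp hpq hG
    ((LocalSystem.ofHom f).comap (T.retraction.comp h))
  refine LocalSystem.isCyclic_range f (g := g) (k := c (i x)) fun γ => ?_
  have hγ := hc (i.comp γ.toContinuousMap)
  have hcomp : (T.retraction.comp h).comp (i.comp γ.toContinuousMap) = γ.toContinuousMap :=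
    ContinuousMap.ext fun t => hri _
  rw [LocalSystem.comap_val, hcomp] at hγ
  have h0 : (i.comp γ.toContinuousMap) 0 = i x := congrArg i γ.source
  have h1 : (i.comp γ.toContinuousMap) 1 = i x := congrArg i γ.target
  rwa [h0, h1] at hγ
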